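/- Let $D=\{z\in\mathbb C:|z|<1\}$, $0<p\le 1$ and $1<q\le\infty$. For $g:D\to\mathbb C$ put $$\|g\|_{H^p(D)}=\Big(\sup_{0<r<1}\frac1{2\pi}\int_0^{2\pi}|g(re^{i\theta})|^p\,d\theta\Big)^{1/p}.$$ Let $H^p(D)$ be the set of holomorphic $\Phi$ on $D$ with $\|\Phi\|_{H^p(D)}<\infty$. For $f\in L^q(D)$ let $H^p_{f,q}(D)$ be the set of $w:D\to\mathbb C$ with $\|w\|_{H^p(D)}<\infty$ that are generalized solutions of $\partial w/\partial\bar z=f$ in $D$, i.e. $w\in L^1_{loc}(D)$ and $\iint_D w\,\frac{\partial\varphi}{\partial\bar z}\,dx\,dy=-\iint_D f\varphi\,dx\,dy$ for all $\varphi\in C_c^\infty(D)$. As generalized solutions are determined only up to planar null sets, $w$ is taken to be a representative that is precise on circles: for every $0<r<1$ and almost every $\theta$, the number $w(re^{i\theta})$ is the Lebesgue value of $w$ at $re^{i\theta}$ whenever one exists. Here $c$ is the Lebesgue value of $w$ at $z$ if $\frac{1}{\pi\rho^2}\iint_{|\zeta-z|<\rho}|w(\zeta)-c|\,d\xi\,d\eta\to0$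 as $\rho\to0^+$ $(\zeta=\xi+i\eta)$. Set $$\widetilde T(f)(z)=-\frac1\pi\iint_D\left(\frac{f(\zeta)}{\zeta-z}+\frac{z\,\overline{f(\zeta)}}{1-\overline\zeta z}\right)d\xi\,d\eta$$ at those $z$ where the integral converges absolutely, and $\widetilde T(f)(z)=0$ at the others. A function $g$ on $D$ has the boundary value $g_b$ in the sense of distributions, where $g_b$ is a distribution on $\partial D$ (a continuous linear functional on the space $C^\infty(\partial D)$ of smooth $2\pi$-periodic functions), if for every $\varphi\in C^\infty(\partial D)$ the integrals $\int_0^{2\pi}g(re^{i\theta})\varphi(\theta)\,d\theta$, $0<r<1$, are defined and $$\langle g_b,\varphi\rangle=\lim_{r\nearrow1}\int_0^{2\pi}g(re^{i\theta})\varphi(\theta)\,d\theta .$$ **Theorem.** Let $w\in H^p_{f,q}(D)$. Then there is $\Phi\in H^p(D)$ with $$w(z)=\Phi(z)+\widetilde T(f)(z),$$ where the integral defining $\widetilde T(f)(z)$ converges absolutely and this equality holds for almost every $z\in D$ and, for every $0<r<1$, at almost every point of the circle $|z|=r$; the equality also holds at every $z\in D$ at which that integral converges absolutely and $w(z)$ is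 the Lebesgue value of $w$ at $z$ whenever one exists. Moreover, the boundary values in the sense of distributions $w_b$, $\Phi_b$ and $(\widetilde T(f))_b$ of $w$, $\Phi$ and $\widetilde T(f)$ exist, and $$w_b=\Phi_b+(\widetilde T(f))_b .$$ -/

import Mathlib

open MeasureTheory Set Filter Topology
open scoped ENNReal ContDiff ComplexConjugate

noncomputable section

namespace VekuaHardy

/-- The open unit disk `D` of the complex plane. -/
def disk : Set ℂ := Metric.ball (0 : ℂ) 1

/-- The Wirtinger derivative `∂φ/∂z̄ = (∂φ/∂x + i ∂φ/∂y) / 2`. -/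
def dbar (φ : ℂ → ℂ) (z : ℂ) : ℂ :=
  (1 / 2 : ℂ) * (fderiv ℝ φ z 1 + Complex.I * fderiv ℝ φ z Complex.I)

/-- `w` is a generalized (distributional) solution of `∂w/∂z̄ = f` in `D`: both functions are
locally integrable in `D`, and `∬_D w ∂φ/∂z̄ = - ∬_D f φ` for all smooth `φ` with compact support
contained in `D`. -/
def IsDbarSolution (f w : ℂ → ℂ) : Prop :=
  LocallyIntegrableOn w disk volume ∧ LocallyIntegrableOn f disk volume ∧
    ∀ φ : ℂ → ℂ, ContDiff ℝ ∞ φ → HasCompactSupport φ → tsupport φ ⊆ disk →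
      ∫ z in disk, w z * dbar φ z = -∫ z in disk, f z * φ z

/-- `z` is a Lebesgue point of (the a.e. class of) `w`, with Lebesgue value `c`. -/
def HasLebesgueValue (w : ℂ → ℂ) (z c : ℂ) : Prop :=
  Tendsto (fun ρ : ℝ => ⨍ ζ in Metric.ball z ρ, ‖w ζ - c‖) (𝓝[>] 0) (𝓝 0)

/-- The value of `w` at `z` is the Lebesgue value of `w` at `z`, provided that there is one. -/
def IsPreciseAt (w : ℂ → ℂ) (z : ℂ) : Prop :=
  ∀ c : ℂ, HasLebesgueValue w z c → w z = c

/-- `w` is a precise representative of its a.e. class, up to a null set of angles on each circle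
`|z| = r`, `0 < r < 1`. Every a.e. class has such a representative, and continuous functions
are of this kind. A generalized solution is only determined up to planar null sets, and circles are
planar null sets; this fixes its restrictions to the circles. -/
def IsPreciseOnCircles (w : ℂ → ℂ) : Prop :=
  ∀ r ∈ Ioo (0 : ℝ) 1, ∀ᵐ θ : ℝ, IsPreciseAt w (circleMap 0 r θ)

/-- The Hardy quasi-norm
`‖w‖_{H^p(D)} = (sup_{0<r<1} (1/2π) ∫_0^{2π} |w(r e^{iθ})|^p dθ)^{1/p}`, possibly infinite. -/
def hardyNorm (p : ℝ) (w : ℂ → ℂ) : ℝ≥0∞ :=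
  (⨆ r ∈ Ioo (0 : ℝ) 1, (ENNReal.ofReal (2 * Real.pi))⁻¹ *
    ∫⁻ θ in Ioc (0 : ℝ) (2 * Real.pi), ‖w (circleMap 0 r θ)‖ₑ ^ p) ^ (1 / p)

/-- The holomorphic Hardy space `H^p(D)`. -/
def HolHardy (p : ℝ) : Set (ℂ → ℂ) :=
  {Φ | DifferentiableOn ℂ Φ disk ∧ hardyNorm p Φ < ⊤}

/-- The Hardy class `H^p_f(D)` of solutions of `∂w/∂z̄ = f`. -/
def HardyClass (p : ℝ) (f : ℂ → ℂ) : Set (ℂ → ℂ) :=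
  {w | IsDbarSolution f w ∧ IsPreciseOnCircles w ∧ hardyNorm p w < ⊤}

/-- The class `H^p_{f,q}(D)`: the members of `H^p_f(D)`, where `f ∈ L^q(D)`. -/
def HardyClassLq (p : ℝ) (f : ℂ → ℂ) (q : ℝ≥0∞) : Set (ℂ → ℂ) :=
  {w | MemLp f q (volume.restrict disk) ∧ w ∈ HardyClass p f}

/-- The modified (reflected) kernel applied to `f`:
`f(ζ)/(ζ - z) + z conj(f(ζ)) / (1 - conj(ζ) z)`. -/
def modifiedIntegrand (f : ℂ → ℂ) (z ζ : ℂ) : ℂ :=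
  f ζ / (ζ - z) + z * conj (f ζ) / (1 - conj ζ * z)

/-- The integral defining the modified Vekua operator at `z` converges absolutely. -/
def ModifiedDefinedAt (f : ℂ → ℂ) (z : ℂ) : Prop :=
  IntegrableOn (modifiedIntegrand f z) disk volume

/-- The modified Vekua operator `T̃(f)(z) = -(1/π) ∬_D (f(ζ)/(ζ - z) + z conj(f(ζ))/(1 - conj(ζ) z))`
(the value `0` is used where the integral does not converge absolutely). -/
def modifiedT (f : ℂ → ℂ) (z : ℂ) : ℂ :=
  -(1 / (Real.pi : ℂ)) * ∫ ζ in disk, modifiedIntegrand f z ζ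

/-- `C^∞(∂D)`: smooth `2π`-periodic complex functions of the angle. -/
def CircleTest : Submodule ℂ (ℝ → ℂ) where
  carrier := {φ | ContDiff ℝ ∞ φ ∧ Function.Periodic φ (2 * Real.pi)}
  zero_mem' := ⟨contDiff_const, fun _ => rfl⟩
  add_mem' := fun ha hb => ⟨ha.1.add hb.1, ha.2.add hb.2⟩
  smul_mem' := fun c _ ha => ⟨contDiff_const.smul ha.1, ha.2.smul c⟩

/-- `𝓓'(∂D)`: the linear functionals on `C^∞(∂D)` that are continuous, i.e. bounded by a constant
times the maximum of the sup norms of finitely many derivatives. -/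
def CircleDistribution : Submodule ℂ (CircleTest →ₗ[ℂ] ℂ) where
  carrier := {u | ∃ (k : ℕ) (C : ℝ), ∀ (φ : CircleTest) (M : ℝ),
    (∀ j ≤ k, ∀ θ : ℝ, ‖iteratedDeriv j (φ : ℝ → ℂ) θ‖ ≤ M) → ‖u φ‖ ≤ C * M}
  zero_mem' := ⟨0, 0, fun φ M _ => by simp⟩
  add_mem' := by
    rintro u v ⟨k, C, hu⟩ ⟨l, B, hv⟩
    refine ⟨max k l, C + B, fun φ M h => ?_⟩
    have h1 := hu φ M fun j hj => h j (hj.trans (le_max_left _ _))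
    have h2 := hv φ M fun j hj => h j (hj.trans (le_max_right _ _))
    calc ‖(u + v) φ‖ ≤ ‖u φ‖ + ‖v φ‖ := norm_add_le _ _
      _ ≤ (C + B) * M := by linarith
  smul_mem' := by
    rintro c u ⟨k, C, hu⟩
    refine ⟨k, ‖c‖ * C, fun φ M h => ?_⟩
    calc ‖(c • u) φ‖ = ‖c‖ * ‖u φ‖ := norm_smul c (u φ)
      _ ≤ ‖c‖ * (C * M) := mul_le_mul_of_nonneg_left (hu φ M h) (norm_nonneg _)
      _ = ‖c‖ * C * M := by ring

/-- The distribution `u` on `∂D` is the boundary value of `g` in the sense of distributions: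
for all `φ ∈ C^∞(∂D)`, the integrals `∫_0^{2π} g(r e^{iθ}) φ(θ) dθ`, `0 < r < 1`, are defined and
tend to `⟨u, φ⟩` as `r ↗ 1`. -/
def HasBoundaryValue (g : ℂ → ℂ) (u : CircleDistribution) : Prop :=
  ∀ φ : CircleTest,
    (∀ r ∈ Ioo (0 : ℝ) 1, IntervalIntegrable
      (fun θ : ℝ => g (circleMap 0 r θ) * (φ : ℝ → ℂ) θ) volume 0 (2 * Real.pi)) ∧
    Tendsto (fun r : ℝ => ∫ θ in (0 : ℝ)..(2 * Real.pi),
      g (circleMap 0 r θ) * (φ : ℝ → ℂ) θ) (𝓝[<] 1) (𝓝 (u.1 φ))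

end VekuaHardy

end

open VekuaHardy

/-! Write `Cf` for the Cauchy transform of `f`. It solves `∂w/∂z̄ = f`, so by Weyl's lemma `w - Cf`
agrees a.e. with a holomorphic `g`. The operator `T̃f` is `Cf` plus a holomorphic reflected term
`Rf`, so `Φ = g - Rf` is the only candidate. What remains concerns null sets, size and boundary
limits.

Null sets. Suppose the potential `∬_D |f(ζ)|/|z-ζ|` is finite at `z`. Means of `|x-ζ|⁻¹` over discs
about `z` are at most `4|z-ζ|⁻¹`, so dominated convergence shows that `Cf(z)` is the Lebesgue value
of `Cf` at `z`. Hence the identity holds wherever `w` is precise and the potential is finite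
(`hasLebesgueValue_add_cauchyTransform`). On each circle the potential is finite a.e.: its integral
over `|z| = r` is `O(1/r)` by Hölder's inequality, and this is where `q > 1` enters
(`exists_lintegral_potential_circle_le`).

Size. The potential dominates `|T̃f|`, so `T̃f` has bounded means on circles away from the origin.
As `p ≤ 1`, `|Φ|^p ≤ |w|^p + |T̃f|^p`, which puts `Φ` in `H^p`.

Boundary values. A function in `H^p` grows at most like a power of `1/(1-|z|)`
(`weighted_bound_of_hardy`), so its Taylor coefficients grow polynomially while the Fourier
coefficients of a test function decay rapidly; the paired series converges up to `r = 1`. For `T̃f`,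
the kernel is first paired with `φ` over the circle. A geometric expansion bounds this pairing by a
constant times `|f(ζ)|`, uniformly in `r` near 1, and dominated convergence in `ζ` finishes. The
identity on circles then transfers the sum of the two boundary values to `w`. -/

namespace VekuaHardy

/-! ### Polar coordinates and the integrability of `1/|z|` -/

theorem lintegral_norm_polar (g : ℝ → ℝ≥0∞) (hg : Measurable g) :
    ∫⁻ z : ℂ, g ‖z‖ = ENNReal.ofReal (2 * Real.pi) *
      ∫⁻ r in Ioi (0 : ℝ), ENNReal.ofReal r * g r := by
  rw [← Complex.lintegral_comp_polarCoord_symm]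
  have h : ∀ p ∈ polarCoord.target, ENNReal.ofReal p.1 • g ‖Complex.polarCoord.symm p‖
      = ENNReal.ofReal p.1 * g p.1 := by
    rintro ⟨r, t⟩ ⟨hr, -⟩
    rw [Complex.norm_polarCoord_symm, smul_eq_mul]
    simp only [mem_Ioi] at hr
    rw [abs_of_pos hr]
  rw [setLIntegral_congr_fun polarCoord.open_target.measurableSet h]
  change ∫⁻ p in Ioi (0 : ℝ) ×ˢ Ioo (-Real.pi) Real.pi, _ ∂(volume.prod volume) = _
  rw [← Measure.prod_restrict, lintegral_prod _ (by fun_prop)]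
  simp only [lintegral_const, Measure.restrict_apply MeasurableSet.univ, univ_inter,
    Real.volume_Ioo]
  rw [lintegral_mul_const _ (by fun_prop), mul_comm]
  congr 2; ring

theorem setLIntegral_norm_ball (g : ℝ → ℝ≥0∞) (hg : Measurable g) (R : ℝ) :
    ∫⁻ z in Metric.ball (0 : ℂ) R, g ‖z‖ = ENNReal.ofReal (2 * Real.pi) *
      ∫⁻ r in Ioo (0 : ℝ) R, ENNReal.ofReal r * g r := by
  have h := lintegral_norm_polar ((Iio R).indicator g) (hg.indicator measurableSet_Iio)
  have e : (fun z : ℂ => (Iio R).indicator g ‖z‖) =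
      (Metric.ball (0 : ℂ) R).indicator (fun z => g ‖z‖) := by
    ext z; simp [indicator]
  have e' : (fun r : ℝ => ENNReal.ofReal r * (Iio R).indicator g r) =
      (Iio R).indicator (fun r => ENNReal.ofReal r * g r) := by
    ext z; by_cases h : z < R <;> simp [indicator, h]
  rw [e, e', lintegral_indicator measurableSet_ball, lintegral_indicator measurableSet_Iio,
    Measure.restrict_restrict measurableSet_Iio, inter_comm] at h
  exact h

theorem setLIntegral_enorm_inv_ball (R : ℝ) :
    ∫⁻ z in Metric.ball (0 : ℂ) R, ‖z‖ₑ⁻¹ = ENNReal.ofReal (2 * Real.pi) * ENNReal.ofReal R := by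
  have h := setLIntegral_norm_ball (fun r => (ENNReal.ofReal r)⁻¹) (by fun_prop) R
  simp only [ofReal_norm] at h
  rw [h, setLIntegral_congr_fun (g := fun _ => 1) measurableSet_Ioo]
  · simp
  · intro r hr
    exact ENNReal.mul_inv_cancel (by simpa using hr.1) ENNReal.ofReal_ne_top

theorem setLIntegral_enorm_sub_inv_ball (a : ℂ) (R : ℝ) :
    ∫⁻ z in Metric.ball a R, ‖z - a‖ₑ⁻¹ =
      ENNReal.ofReal (2 * Real.pi) * ENNReal.ofReal R := by
  rw [← setLIntegral_enorm_inv_ball R, ← lintegral_indicator measurableSet_ball,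
    ← lintegral_indicator measurableSet_ball,
    ← lintegral_sub_right_eq_self (fun z => (Metric.ball (0 : ℂ) R).indicator _ z) a]
  congr 1; ext z
  simp [indicator, dist_eq_norm]

theorem setLIntegral_enorm_sub_inv_ball_le (a b : ℂ) (R : ℝ) :
    ∫⁻ z in Metric.ball a R, ‖b - z‖ₑ⁻¹ ≤
      ENNReal.ofReal (2 * Real.pi) * ENNReal.ofReal (R + dist a b) := by
  rw [← setLIntegral_enorm_sub_inv_ball b]
  refine (lintegral_mono_set (Metric.ball_subset_ball' (y := b) le_rfl)).trans_eq ?_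
  simp_rw [enorm_sub_rev b]

theorem enorm_inv_le_inv_enorm (z : ℂ) : ‖z⁻¹‖ₑ ≤ ‖z‖ₑ⁻¹ := by
  rcases eq_or_ne z 0 with rfl | h
  · simp
  · rw [enorm_inv h]

theorem locallyIntegrable_inv : LocallyIntegrable (fun z : ℂ => z⁻¹) := by
  rw [locallyIntegrable_iff]
  intro K hK
  obtain ⟨R, hR⟩ := hK.isBounded.subset_ball 0
  refine IntegrableOn.mono_set ⟨by fun_prop, ?_⟩ hR
  rw [hasFiniteIntegral_iff_enorm]
  refine (lintegral_mono enorm_inv_le_inv_enorm).trans_lt ?_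
  rw [setLIntegral_enorm_inv_ball]
  exact ENNReal.mul_lt_top ENNReal.ofReal_lt_top ENNReal.ofReal_lt_top

/-! ### The Wirtinger derivative and the Cauchy–Pompeiu formula -/

theorem continuous_dbar {φ : ℂ → ℂ} (h : ContDiff ℝ ∞ φ) : Continuous (dbar φ) := by
  have := h.continuous_fderiv (by simp)
  unfold dbar
  fun_prop

theorem tsupport_dbar_subset (φ : ℂ → ℂ) : tsupport (dbar φ) ⊆ tsupport φ := by
  refine closure_minimal (fun z hz => ?_) (isClosed_tsupport φ)
  by_contra h
  have : fderiv ℝ φ z = 0 := by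
    by_contra h'
    exact h (support_fderiv_subset ℝ h')
  simp [dbar, this] at hz

theorem hasCompactSupport_dbar {φ : ℂ → ℂ} (h : HasCompactSupport φ) :
    HasCompactSupport (dbar φ) :=
  h.mono' (subset_closure.trans (tsupport_dbar_subset φ))

/-- The Cauchy–Pompeiu formula for a compactly supported function. -/
theorem integral_dbar_add_mul_inv {ψ : ℂ → ℂ} (h : ContDiff ℝ ∞ ψ) (hc : HasCompactSupport ψ)
    (a : ℂ) : ∫ z : ℂ, dbar ψ (a + z) * z⁻¹ = -(Real.pi * ψ a) := by
  set E : ℝ → ℂ := fun t => Complex.exp (t * Complex.I) with hE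
  have hEc : Continuous E := by fun_prop
  -- `G1` is the radial derivative of `ψ(a + r e^{it})` and `r * G2` its angular derivative.
  set G1 : ℝ × ℝ → ℂ := fun p => fderiv ℝ ψ (a + p.1 * E p.2) (E p.2) with hG1
  set G2 : ℝ × ℝ → ℂ := fun p => fderiv ℝ ψ (a + p.1 * E p.2) (Complex.I * E p.2) with hG2
  have hfc := h.continuous_fderiv (by simp)
  have hd := h.differentiable (by simp)
  have hG1c : Continuous G1 := by fun_prop
  have hG2c : Continuous G2 := by fun_prop
  obtain ⟨R, hR⟩ := hc.isBounded.subset_ball a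
  have hz : ∀ p : ℝ × ℝ, R ≤ p.1 → fderiv ℝ ψ (a + p.1 * E p.2) = 0 := by
    intro p hp
    by_contra h'
    have := hR (support_fderiv_subset ℝ h')
    rw [Metric.mem_ball, dist_eq_norm, add_sub_cancel_left, norm_mul, hE,
      Complex.norm_exp_ofReal_mul_I, mul_one, Complex.norm_real] at this
    exact absurd (this.trans_le (hp.trans (le_abs_self _))) (lt_irrefl _)
  have hint : ∀ G : ℝ × ℝ → ℂ, Continuous G → (∀ p : ℝ × ℝ, R ≤ p.1 → G p = 0) →
      IntegrableOn G (Ioi (0 : ℝ) ×ˢ Ioo (-Real.pi) Real.pi) (volume.prod volume) := by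
    intro G hG h0
    have h1 : IntegrableOn G (Icc (0 : ℝ) R ×ˢ Icc (-Real.pi) Real.pi) (volume.prod volume) :=
      hG.continuousOn.integrableOn_compact (isCompact_Icc.prod isCompact_Icc)
    refine h1.of_forall_sdiff_eq_zero (measurableSet_Ioi.prod measurableSet_Ioo) ?_
    rintro ⟨r, t⟩ ⟨⟨hr, ht⟩, hn⟩
    apply h0
    by_contra hlt
    push Not at hlt
    exact hn ⟨⟨le_of_lt hr, hlt.le⟩, ⟨ht.1.le, ht.2.le⟩⟩
  have hi1 := hint G1 hG1c fun p hp => by simp [hG1, hz p hp]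
  have hi2 := hint G2 hG2c fun p hp => by simp [hG2, hz p hp]
  rw [← Complex.integral_comp_polarCoord_symm]
  -- In polar coordinates `∂/∂z̄ = (e^{it}/2)(∂_r + (i/r)∂_t)`. The factor `e^{it}` cancels against
  -- `r z⁻¹ = e^{-it}`, so the Jacobian removes the singularity.
  have hpt : ∀ p ∈ polarCoord.target, p.1 • (dbar ψ (a + Complex.polarCoord.symm p) *
      (Complex.polarCoord.symm p)⁻¹) = (1 / 2 : ℂ) * (G1 p + Complex.I * G2 p) := by
    rintro ⟨r, t⟩ ⟨hr, -⟩
    simp only [mem_Ioi] at hr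
    have hr' : (r : ℂ) ≠ 0 := by exact_mod_cast hr.ne'
    have e1 : Complex.polarCoord.symm (r, t) = r * E t := by
      rw [Complex.polarCoord_symm_apply, hE]; simp [Complex.exp_mul_I]
    have e2 : ∀ c : ℂ, fderiv ℝ ψ (a + r * E t) c = c.re * fderiv ℝ ψ (a + r * E t) 1 +
        c.im * fderiv ℝ ψ (a + r * E t) Complex.I := by
      intro c
      conv_lhs => rw [show c = c.re • (1 : ℂ) + c.im • Complex.I by
        simp [Complex.re_add_im]]
      rw [map_add, map_smul, map_smul]; simp
    have hEt : E t = Real.cos t + Real.sin t * Complex.I := by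
      simp [hE, Complex.exp_mul_I]
    have hEi : (E t)⁻¹ = Real.cos t - Real.sin t * Complex.I := by
      rw [hE]; simp only [← Complex.exp_neg]
      rw [show -(t * Complex.I : ℂ) = (-t : ℂ) * Complex.I by ring, Complex.exp_mul_I]
      simp; ring
    have hre : (E t).re = Real.cos t := Complex.exp_ofReal_mul_I_re t
    have him : (E t).im = Real.sin t := Complex.exp_ofReal_mul_I_im t
    simp only [e1, hG1, hG2, dbar]
    rw [e2 (E t), e2 (Complex.I * E t), mul_inv, hEi, Complex.real_smul]
    have hre2 : (Complex.I * E t).re = -Real.sin t := by simp [him]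
    have him2 : (Complex.I * E t).im = Real.cos t := by simp [hre]
    rw [hre, him, hre2, him2]
    field_simp
    push_cast
    linear_combination (-(Complex.sin t) * (fderiv ℝ ψ (a + r * E t)) Complex.I) * Complex.I_sq
  rw [setIntegral_congr_fun polarCoord.open_target.measurableSet hpt]
  change ∫ p in Ioi (0 : ℝ) ×ˢ Ioo (-Real.pi) Real.pi, _ ∂(volume.prod volume) = _
  rw [integral_const_mul, integral_add hi1 (hi2.const_mul _), integral_const_mul]
  have hder : ∀ (r t : ℝ), HasDerivAt (fun r : ℝ => ψ (a + r * E t)) (G1 (r, t)) r := by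
    intro r t
    refine (hd _).hasFDerivAt.comp_hasDerivAt (f := fun r : ℝ => a + r * E t) r ?_
    simpa using ((Complex.ofRealCLM.hasDerivAt (x := r)).mul_const (E t)).const_add a
  have hder2 : ∀ (r t : ℝ), HasDerivAt (fun t : ℝ => ψ (a + r * E t)) (r * G2 (r, t)) t := by
    intro r t
    have hEd : HasDerivAt E (E t * Complex.I) t := by
      have := ((Complex.ofRealCLM.hasDerivAt (x := t)).mul_const Complex.I).cexp
      simpa [hE] using this
    have := (hd (a + r * E t)).hasFDerivAt.comp_hasDerivAt (f := fun t : ℝ => a + r * E t) t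
      ((hEd.const_mul (r : ℂ)).const_add a)
    refine this.congr_deriv ?_
    change _ = (r : ℂ) * fderiv ℝ ψ (a + r * E t) (Complex.I * E t)
    rw [← Complex.real_smul, ← Complex.real_smul, map_smul, mul_comm Complex.I, Complex.real_smul,
      Complex.real_smul]
  -- Each ray contributes `-ψ(a)` by the fundamental theorem of calculus, and there are `2π` of
  -- them.
  have h1 : ∫ p in Ioi (0 : ℝ) ×ˢ Ioo (-Real.pi) Real.pi, G1 p ∂(volume.prod volume) =
      -(2 * Real.pi * ψ a) := by
    rw [← setIntegral_prod_swap]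
    refine (setIntegral_prod _ hi1.swap).trans ?_
    have : ∀ t : ℝ, ∫ r in Ioi (0 : ℝ), G1 (r, t) = - ψ a := by
      intro t
      have hEt : E t ≠ 0 := Complex.exp_ne_zero _
      have hcs : HasCompactSupport (fun r : ℝ => ψ (a + r * E t)) := by
        refine HasCompactSupport.of_support_subset_isCompact (isCompact_Icc (a := -R) (b := R)) ?_
        intro r hr
        have := hR (subset_closure hr)
        rw [Metric.mem_ball, dist_eq_norm, add_sub_cancel_left, norm_mul, hE,
          Complex.norm_exp_ofReal_mul_I, mul_one, Complex.norm_real] at this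
        exact ⟨(abs_lt.1 this).1.le, (abs_lt.1 this).2.le⟩
      have hder' : deriv (fun r : ℝ => ψ (a + r * E t)) = fun r => G1 (r, t) :=
        funext fun r => (hder r t).deriv
      have := hcs.integral_Ioi_deriv_eq (contDiff_one_iff_deriv.2
        ⟨fun r => (hder r t).differentiableAt, by
        rw [hder']; fun_prop⟩) 0
      rw [hder'] at this
      simpa using this
    change ∫ t in Ioo (-Real.pi) Real.pi, ∫ r in Ioi (0 : ℝ), G1 (r, t) = _
    simp only [this]
    simp [Real.pi_pos.le]
    left; ring
  -- The angular derivative integrates to zero over a full turn.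
  have h2 : ∫ p in Ioi (0 : ℝ) ×ˢ Ioo (-Real.pi) Real.pi, G2 p ∂(volume.prod volume) = 0 := by
    rw [setIntegral_prod _ hi2]
    refine (setIntegral_congr_fun (g := fun _ => 0) measurableSet_Ioi ?_).trans (by simp)
    intro r hr
    have hr' : (r : ℂ) ≠ 0 := by exact_mod_cast (ne_of_gt hr)
    have := intervalIntegral.integral_eq_sub_of_hasDerivAt (a := -Real.pi) (b := Real.pi)
      (fun t _ => hder2 r t) (Continuous.intervalIntegrable (by fun_prop) _ _)
    rw [intervalIntegral.integral_const_mul, intervalIntegral.integral_of_le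
      (by linarith [Real.pi_pos]), integral_Ioc_eq_integral_Ioo] at this
    have e : E Real.pi = E (-Real.pi) := by simp [hE, Complex.exp_neg]
    rw [e, sub_self] at this
    exact (mul_eq_zero.1 this).resolve_left hr'
  rw [h1, h2]; ring

/-! ### The Cauchy transform -/

/-- Tonelli with `z` integrated first: the disc of radius `R` about 0 lies in the disc of radius `R
+ 1` about `ζ`, on which `|z-ζ|⁻¹` has integral `2π(R+1)`. This gives a.e. absolute convergence and
local integrability of the Cauchy transform, and justifies Fubini. -/
theorem integrable_cauchy_kernel {F : ℂ → ℂ} (hF : IntegrableOn F disk) (R : ℝ) :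
    Integrable (fun p : ℂ × ℂ => F p.2 * (p.1 - p.2)⁻¹)
      ((volume.restrict (Metric.ball 0 R)).prod (volume.restrict disk)) := by
  have hm : AEStronglyMeasurable (fun p : ℂ × ℂ => F p.2 * (p.1 - p.2)⁻¹)
      ((volume.restrict (Metric.ball 0 R)).prod (volume.restrict disk)) := by
    refine hF.1.comp_snd.mul ?_
    exact (Measurable.aestronglyMeasurable (by fun_prop))
  refine ⟨hm, ?_⟩
  rw [hasFiniteIntegral_iff_enorm, lintegral_prod_symm _ hm.enorm]
  calc ∫⁻ ζ in disk, ∫⁻ z in Metric.ball 0 R, ‖F ζ * (z - ζ)⁻¹‖ₑ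
      ≤ ∫⁻ ζ in disk, ‖F ζ‖ₑ *
          (ENNReal.ofReal (2 * Real.pi) * ENNReal.ofReal (R + 1)) := by
        refine setLIntegral_mono' measurableSet_ball fun ζ hζ => ?_
        simp only [enorm_mul]
        rw [lintegral_const_mul _ (by fun_prop)]
        gcongr
        calc ∫⁻ z in Metric.ball 0 R, ‖(z - ζ)⁻¹‖ₑ ≤ ∫⁻ z in Metric.ball 0 R, ‖ζ - z‖ₑ⁻¹ := by
              refine lintegral_mono fun z => ?_
              rw [enorm_sub_rev]
              exact enorm_inv_le_inv_enorm _
          _ ≤ _ := setLIntegral_enorm_sub_inv_ball_le 0 ζ R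
          _ ≤ _ := by
              gcongr
              rw [dist_comm]
              exact (Metric.mem_ball.1 hζ).le
    _ < ⊤ := by
        rw [lintegral_mul_const'' _ hF.1.enorm]
        exact ENNReal.mul_lt_top hF.2
          (ENNReal.mul_lt_top ENNReal.ofReal_lt_top ENNReal.ofReal_lt_top)

/-- The Cauchy transform `(1/π) ∬_D F(ζ)/(z - ζ)`. -/
noncomputable def cauchyTransform (F : ℂ → ℂ) (z : ℂ) : ℂ :=
  (1 / (Real.pi : ℂ)) * ∫ ζ in disk, F ζ * (z - ζ)⁻¹

theorem integrableOn_cauchyTransform {F : ℂ → ℂ} (hF : IntegrableOn F disk) (R : ℝ) :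
    IntegrableOn (cauchyTransform F) (Metric.ball 0 R) :=
  (integrable_cauchy_kernel hF R).integral_prod_left.const_mul _

theorem integral_cauchyTransform_mul {F ψ : ℂ → ℂ} (hF : IntegrableOn F disk)
    (hψ : Continuous ψ) (hc : HasCompactSupport ψ) :
    ∫ z, cauchyTransform F z * ψ z =
      (1 / (Real.pi : ℂ)) * ∫ ζ in disk, F ζ * ∫ z, (z - ζ)⁻¹ * ψ z := by
  obtain ⟨R, hR⟩ := hc.isBounded.subset_ball 0
  have hz : ∀ z, z ∉ Metric.ball (0 : ℂ) R → ψ z = 0 := fun z h =>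
    image_eq_zero_of_notMem_tsupport fun h' => h (hR h')
  have h1 : ∀ g : ℂ → ℂ, ∫ z, g z * ψ z = ∫ z in Metric.ball 0 R, g z * ψ z := fun g =>
    (setIntegral_eq_integral_of_forall_compl_eq_zero fun z h => by simp [hz z h]).symm
  rw [h1]
  simp only [h1, cauchyTransform, mul_assoc]
  rw [integral_const_mul]
  congr 1
  simp only [← integral_mul_const, ← integral_const_mul]
  obtain ⟨M, hM⟩ := hψ.norm.bounded_above_of_compact_support hc.norm
  have hi : Integrable (fun p : ℂ × ℂ => ψ p.1 * (F p.2 * (p.1 - p.2)⁻¹))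
      ((volume.restrict (Metric.ball 0 R)).prod (volume.restrict disk)) :=
    (integrable_cauchy_kernel hF R).bdd_mul (c := M)
      (hψ.comp continuous_fst).aestronglyMeasurable
      (Eventually.of_forall fun p => by simpa using hM p.1)
  have hi' : Integrable (Function.uncurry fun (z ζ : ℂ) => F ζ * (z - ζ)⁻¹ * ψ z)
      ((volume.restrict (Metric.ball 0 R)).prod (volume.restrict disk)) := by
    refine hi.congr (Eventually.of_forall fun p => ?_)
    simp only [Function.uncurry]; ring
  rw [integral_integral_swap hi']
  simp only [mul_assoc]

theorem integral_sub_inv_mul_dbar {φ : ℂ → ℂ} (h : ContDiff ℝ ∞ φ) (hc : HasCompactSupport φ)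
    (ζ : ℂ) : ∫ z, (z - ζ)⁻¹ * dbar φ z = -(Real.pi * φ ζ) := by
  rw [← integral_dbar_add_mul_inv h hc ζ,
    ← integral_add_left_eq_self (fun z => (z - ζ)⁻¹ * dbar φ z) ζ]
  simp [mul_comm]

/-- The Cauchy transform of `F` solves `∂w/∂z̄ = F` in the sense of distributions. -/
theorem integral_cauchyTransform_mul_dbar {F φ : ℂ → ℂ} (hF : IntegrableOn F disk)
    (h : ContDiff ℝ ∞ φ) (hc : HasCompactSupport φ) :
    ∫ z, cauchyTransform F z * dbar φ z = -∫ ζ in disk, F ζ * φ ζ := by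
  rw [integral_cauchyTransform_mul hF (continuous_dbar h) (hasCompactSupport_dbar hc)]
  simp only [integral_sub_inv_mul_dbar h hc]
  rw [← integral_const_mul, ← integral_neg]
  congr 1; ext ζ
  have : (Real.pi : ℂ) ≠ 0 := by exact_mod_cast Real.pi_ne_zero
  field_simp

/-- Where `F` vanishes near `z` the singularity stays a fixed distance `δ` away, so differentiation
under the integral is dominated by `|F| δ⁻²`. -/
theorem differentiableAt_cauchyTransform {F : ℂ → ℂ} (hF : IntegrableOn F disk) {R : ℝ}
    (h0 : ∀ z ∈ Metric.ball (0 : ℂ) R, F z = 0) {z : ℂ} (hz : z ∈ Metric.ball (0 : ℂ) R) :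
    DifferentiableAt ℂ (cauchyTransform F) z := by
  obtain ⟨δ, hδ, hsub⟩ : ∃ δ > 0, Metric.ball z (2 * δ) ⊆ Metric.ball 0 R := by
    obtain ⟨ε, hε, h⟩ := Metric.isOpen_ball.mem_nhds hz |> Metric.mem_nhds_iff.1
    exact ⟨ε / 2, by positivity, by rwa [mul_div_cancel₀ _ two_ne_zero]⟩
  have hdist : ∀ ζ, F ζ ≠ 0 → ∀ x ∈ Metric.ball z δ, δ ≤ ‖x - ζ‖ := by
    intro ζ hζ x hx
    by_contra hlt
    push Not at hlt
    refine hζ (h0 ζ (hsub ?_))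
    rw [Metric.mem_ball, dist_eq_norm] at hx ⊢
    calc ‖ζ - z‖ = ‖(x - z) - (x - ζ)‖ := by ring_nf
      _ ≤ ‖x - z‖ + ‖x - ζ‖ := norm_sub_le _ _
      _ < 2 * δ := by linarith
  have hmeas : ∀ x : ℂ, AEStronglyMeasurable (fun ζ => F ζ * (x - ζ)⁻¹) (volume.restrict disk) :=
    fun x => hF.1.mul (Measurable.aestronglyMeasurable (by fun_prop))
  have key := hasDerivAt_integral_of_dominated_loc_of_deriv_le (𝕜 := ℂ)
    (μ := volume.restrict disk) (F := fun x ζ => F ζ * (x - ζ)⁻¹) (x₀ := z)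
    (s := Metric.ball z δ) (bound := fun ζ => ‖F ζ‖ * (δ ^ 2)⁻¹)
    (F' := fun x ζ => F ζ * (-((x - ζ) ^ 2)⁻¹)) (Metric.ball_mem_nhds _ hδ)
    (Eventually.of_forall hmeas) ?_ ?_ ?_ (hF.norm.mul_const _) ?_
  · exact (key.2.differentiableAt.const_mul _)
  · refine (hF.norm.mul_const δ⁻¹).mono' (hmeas z) (Eventually.of_forall fun ζ => ?_)
    rcases eq_or_ne (F ζ) 0 with h | h
    · simp [h]
    · rw [norm_mul, norm_inv]
      gcongr
      exact hdist ζ h z (Metric.mem_ball_self hδ)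
  · exact hF.1.mul (Measurable.aestronglyMeasurable (by fun_prop))
  · refine Eventually.of_forall fun ζ x hx => ?_
    rcases eq_or_ne (F ζ) 0 with h | h
    · simp [h]
    · rw [norm_mul, norm_neg, norm_inv, norm_pow]
      gcongr
      exact hdist ζ h x hx
  · refine Eventually.of_forall fun ζ x hx => ?_
    rcases eq_or_ne (F ζ) 0 with h | h
    · simp [h, hasDerivAt_const]
    · have hne : x - ζ ≠ 0 := norm_pos_iff.1 (hδ.trans_le (hdist ζ h x hx))
      have := (((hasDerivAt_id x).sub_const ζ).inv hne).const_mul (F ζ)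
      refine this.congr_deriv ?_
      simp [neg_div]

/-! ### Weyl's lemma for the Cauchy–Riemann operator -/

/-- The function is a convolution of `ψ` with a locally integrable kernel, so derivatives fall on
`ψ` and Cauchy–Pompeiu evaluates the result. The solution need not have compact support, hence the
cutoff in Weyl's lemma. -/
theorem exists_dbar_eq {ψ : ℂ → ℂ} (h : ContDiff ℝ ∞ ψ) (hc : HasCompactSupport ψ) :
    ContDiff ℝ ∞ (fun z => ∫ ζ, (ζ - z)⁻¹ * ψ ζ) ∧
      ∀ z, dbar (fun z => ∫ ζ, (ζ - z)⁻¹ * ψ ζ) z = -(Real.pi * ψ z) := by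
  set L := ContinuousLinearMap.mul ℝ ℂ
  have e : (fun z => ∫ ζ, (ζ - z)⁻¹ * ψ ζ) =
      fun z => -(convolution (fun z : ℂ => z⁻¹) ψ L volume z) := by
    ext z
    rw [convolution_def, ← integral_neg,
      ← integral_sub_left_eq_self (fun ζ => (ζ - z)⁻¹ * ψ ζ) volume z]
    congr 1; ext t
    simp [L, neg_mul, inv_neg]
  have hsm := hc.contDiff_convolution_right (n := ⊤) L locallyIntegrable_inv h
  have hder := fun z => hc.hasFDerivAt_convolution_right L locallyIntegrable_inv
    (h.of_le (by simp)) z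
  rw [e]
  refine ⟨hsm.neg, fun z => ?_⟩
  have hf : fderiv ℝ (fun z => -(convolution (fun z : ℂ => z⁻¹) ψ L volume z)) z =
      -(convolution (fun z : ℂ => z⁻¹) (fderiv ℝ ψ) (L.precompR ℂ) volume z) :=
    (hder z).neg.fderiv
  have hap : ∀ v, fderiv ℝ (fun z => -(convolution (fun z : ℂ => z⁻¹) ψ L volume z)) z v =
      -∫ t : ℂ, t⁻¹ * fderiv ℝ ψ (z - t) v := fun v => by
    rw [hf, neg_apply]
    exact congrArg Neg.neg (convolution_precompR_apply L locallyIntegrable_inv (hc.fderiv ℝ)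
      (h.continuous_fderiv (by simp)) z v)
  have hint : ∀ v : ℂ, Integrable (fun t : ℂ => t⁻¹ * fderiv ℝ ψ (z - t) v) := by
    intro v
    have hcv : HasCompactSupport (fun a => fderiv ℝ ψ a v) :=
      (hc.fderiv ℝ).comp_left (g := fun l : ℂ →L[ℝ] ℂ => l v) rfl
    exact hcv.convolutionExists_right L locallyIntegrable_inv
      ((h.continuous_fderiv (by simp)).clm_apply continuous_const) z
  rw [dbar, hap, hap, ← integral_dbar_add_mul_inv h hc z,
    ← integral_neg_eq_self (fun t => dbar ψ (z + t) * t⁻¹)]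
  simp only [dbar]
  rw [← integral_neg, ← integral_neg, ← integral_const_mul, ← integral_add, ← integral_const_mul]
  · congr 1; ext t
    simp only [sub_eq_add_neg, inv_neg]
    ring
  · exact (hint 1).neg
  · exact (hint _).neg.const_mul _

theorem dbar_mul {φ ψ : ℂ → ℂ} {z : ℂ} (hφ : DifferentiableAt ℝ φ z)
    (hψ : DifferentiableAt ℝ ψ z) :
    dbar (fun z => φ z * ψ z) z = φ z * dbar ψ z + ψ z * dbar φ z := by
  simp only [dbar, fderiv_fun_mul hφ hψ, add_apply, smul_apply, smul_eq_mul]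
  ring

theorem setIntegral_disk_eq_integral {g : ℂ → ℂ} (h : tsupport g ⊆ disk) :
    ∫ z in disk, g z = ∫ z, g z :=
  setIntegral_eq_integral_of_forall_compl_eq_zero fun _ hz =>
    image_eq_zero_of_notMem_tsupport fun h' => hz (h h')

theorem tsupport_mul_subset_of_right {u v : ℂ → ℂ} {s : Set ℂ} (h : tsupport v ⊆ s) :
    tsupport (fun z => u z * v z) ⊆ s :=
  (closure_mono (Function.support_mul_subset_right u v)).trans h

theorem integrable_mul_of_tsupport_subset {u v : ℂ → ℂ} (hu : LocallyIntegrableOn u disk)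
    (hv : Continuous v) (hc : HasCompactSupport v) (hs : tsupport v ⊆ disk) :
    Integrable (fun z => u z * v z) := by
  have h1 : IntegrableOn u (tsupport v) := hu.integrableOn_compact_subset hs hc
  obtain ⟨M, hM⟩ := hv.norm.bounded_above_of_compact_support hc.norm
  have h2 : IntegrableOn (fun z => v z * u z) (tsupport v) :=
    Integrable.bdd_mul (c := M) h1 hv.aestronglyMeasurable
      (Eventually.of_forall fun p => by simpa using hM p)
  refine ((integrableOn_iff_integrable_of_support_subset ?_).1 h2).congr
    (Eventually.of_forall fun z => mul_comm _ _)
  exact (Function.support_mul_subset_left _ _).trans subset_closure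

/-- Weyl's lemma for `∂/∂z̄`, on a smaller disk. -/
theorem exists_holomorphic_ball {u : ℂ → ℂ} (hu : LocallyIntegrableOn u disk)
    (h : ∀ φ : ℂ → ℂ, ContDiff ℝ ∞ φ → HasCompactSupport φ → tsupport φ ⊆ disk →
      ∫ z in disk, u z * dbar φ z = 0) {R : ℝ} (hR0 : 0 < R) (hR1 : R < 1) :
    ∃ g : ℂ → ℂ, DifferentiableOn ℂ g (Metric.ball 0 R) ∧
      ∀ᵐ z, z ∈ Metric.ball (0 : ℂ) R → u z = g z := by
  -- The cutoff equals 1 on the ball of radius `R` and is supported in radius `(1 + R)/2 < 1`.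
  let B : ContDiffBump (0 : ℂ) := ⟨R, (1 + R) / 2, hR0, by linarith⟩
  set χ : ℂ → ℂ := fun z => (B z : ℂ) with hχ
  have hBdiff : ContDiff ℝ ∞ (fun z => B z) := B.contDiff
  have hχs : ContDiff ℝ ∞ χ := Complex.ofRealCLM.contDiff.comp hBdiff
  have hχt : tsupport χ ⊆ disk := by
    have : tsupport χ ⊆ tsupport B := closure_mono fun z hz => by
      simpa [hχ] using hz
    refine this.trans ?_
    rw [B.tsupport_eq]
    exact Metric.closedBall_subset_ball (by change (1 + R) / 2 < 1; linarith)
  have hχc : HasCompactSupport χ := B.hasCompactSupport.comp_left Complex.ofReal_zero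
  have hdχ0 : ∀ z ∈ Metric.ball (0 : ℂ) R, dbar χ z = 0 := by
    intro z hz
    have : χ =ᶠ[𝓝 z] fun _ => 1 := by
      filter_upwards [B.eventuallyEq_one_of_mem_ball hz] with y hy
      simp [hχ, hy]
    simp [dbar, this.fderiv_eq]
  -- Formally `∂(uχ)/∂z̄ = u ∂χ/∂z̄ = F`, so `uχ` should be the Cauchy transform of `F`. As `F`
  -- vanishes on the small ball, that transform is holomorphic there.
  set F : ℂ → ℂ := fun z => u z * dbar χ z with hF
  have hFi : Integrable F := integrable_mul_of_tsupport_subset hu (continuous_dbar hχs)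
    (hasCompactSupport_dbar hχc) ((tsupport_dbar_subset χ).trans hχt)
  have hpi : (Real.pi : ℂ) ≠ 0 := by exact_mod_cast Real.pi_ne_zero
  refine ⟨cauchyTransform F, fun z hz => (differentiableAt_cauchyTransform hFi.integrableOn
    (fun z hz => by simp [hF, hdχ0 z hz]) hz).differentiableWithinAt, ?_⟩
  have hball : Metric.ball (0 : ℂ) R ⊆ disk := Metric.ball_subset_ball hR1.le
  have hCi := integrableOn_cauchyTransform hFi.integrableOn R
  have hloc : LocallyIntegrableOn (fun z => u z - cauchyTransform F z) (Metric.ball 0 R) :=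
    (hu.mono_set hball).sub hCi.locallyIntegrableOn
  have := Metric.isOpen_ball.ae_eq_zero_of_integral_contDiff_smul_eq_zero hloc ?_
  · filter_upwards [this] with z hz hzR
    exact sub_eq_zero.1 (hz hzR)
  intro ψ' hψ's hψ'c hψ't
  set ψ : ℂ → ℂ := fun z => (ψ' z : ℂ) with hψ
  have hψs : ContDiff ℝ ∞ ψ := Complex.ofRealCLM.contDiff.comp hψ's
  have hψc : HasCompactSupport ψ := hψ'c.comp_left Complex.ofReal_zero
  have hψt : tsupport ψ ⊆ Metric.ball 0 R := by
    refine (closure_mono fun z hz => ?_).trans hψ't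
    simpa [hψ] using hz
  obtain ⟨hKs, hKd⟩ := exists_dbar_eq hψs hψc
  set K : ℂ → ℂ := fun z => ∫ ζ, (ζ - z)⁻¹ * ψ ζ with hK
  have hφt : tsupport (fun z => K z * χ z) ⊆ disk := tsupport_mul_subset_of_right hχt
  have h0 := h (fun z => K z * χ z) (hKs.mul hχs) (hχc.mul_left) hφt
  -- Testing with `Kχ`, where `∂K/∂z̄ = -πψ` and `χ = 1` on the support of `ψ`, gives `π∫uψ = ∫FK`.
  -- By Fubini the latter is `π` times the integral of the Cauchy transform of `F` against `ψ`.
  have hpt : ∀ z, u z * dbar (fun z => K z * χ z) z = F z * K z - Real.pi * (u z * ψ z) := by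
    intro z
    rw [dbar_mul (hKs.differentiable (by simp) z) (hχs.differentiable (by simp) z), hKd]
    have : χ z * ψ z = ψ z := by
      by_cases hz : ψ z = 0
      · simp [hz]
      · have hzR : z ∈ Metric.ball (0 : ℂ) R := hψt (subset_closure hz)
        have : B z = 1 := B.one_of_mem_closedBall (Metric.ball_subset_closedBall hzR)
        simp [hχ, this]
    simp only [hF]
    linear_combination (-(Real.pi : ℂ) * u z) * this
  have hi1 : Integrable fun z => F z * K z := by
    have : (fun z => F z * K z) = fun z => u z * (dbar χ z * K z) := by
      ext z; simp only [hF]; ring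
    rw [this]
    refine integrable_mul_of_tsupport_subset hu ((continuous_dbar hχs).mul hKs.continuous)
      (hasCompactSupport_dbar hχc).mul_right ?_
    exact (closure_mono (Function.support_mul_subset_left _ _)).trans
      ((tsupport_dbar_subset χ).trans hχt)
  have hi2 : Integrable fun z => u z * ψ z :=
    integrable_mul_of_tsupport_subset hu hψs.continuous hψc (hψt.trans hball)
  simp only [hpt] at h0
  rw [integral_sub hi1.integrableOn (hi2.const_mul _).integrableOn, integral_const_mul,
    setIntegral_disk_eq_integral (tsupport_mul_subset_of_right (hψt.trans hball))] at h0
  have h3 := integral_cauchyTransform_mul hFi.integrableOn hψs.continuous hψc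
  have hi3 : Integrable fun z => cauchyTransform F z * ψ z := by
    have h1 : IntegrableOn (fun z => ψ z * cauchyTransform F z) (Metric.ball 0 R) := by
      obtain ⟨M, hM⟩ := hψs.continuous.norm.bounded_above_of_compact_support hψc.norm
      exact Integrable.bdd_mul (c := M) hCi hψs.continuous.aestronglyMeasurable
        (Eventually.of_forall fun p => by simpa using hM p)
    refine ((integrableOn_iff_integrable_of_support_subset ?_).1 h1).congr
      (Eventually.of_forall fun z => mul_comm _ _)
    exact (Function.support_mul_subset_left _ _).trans (subset_closure.trans hψt)
  have e : (fun z => ψ' z • (u z - cauchyTransform F z)) =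
      fun z => u z * ψ z - cauchyTransform F z * ψ z := by
    ext z; simp only [Complex.real_smul, hψ]; ring
  rw [e, integral_sub hi2 hi3, h3, sub_eq_zero]
  change _ = 1 / (Real.pi : ℂ) * ∫ z in disk, F z * K z
  rw [sub_eq_zero.1 h0]
  field_simp

/-- Weyl's lemma for `∂/∂z̄`. -/
theorem exists_holomorphic_disk {u : ℂ → ℂ} (hu : LocallyIntegrableOn u disk)
    (h : ∀ φ : ℂ → ℂ, ContDiff ℝ ∞ φ → HasCompactSupport φ → tsupport φ ⊆ disk →
      ∫ z in disk, u z * dbar φ z = 0) :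
    ∃ g : ℂ → ℂ, DifferentiableOn ℂ g disk ∧ ∀ᵐ z, z ∈ disk → u z = g z := by
  choose! G hGd hGe using fun (R : ℝ) (hR0 : 0 < R) (hR1 : R < 1) =>
    exists_holomorphic_ball hu h hR0 hR1
  have hle : ∀ R S : ℝ, 0 < R → R ≤ S → S < 1 → EqOn (G R) (G S) (Metric.ball 0 R) := by
    intro R S hR hRS hS
    have hsub := Metric.ball_subset_ball (x := (0 : ℂ)) hRS
    refine Measure.eqOn_open_of_ae_eq (μ := volume) ?_ Metric.isOpen_ball
      (hGd R hR (hRS.trans_lt hS)).continuousOn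
      ((hGd S (hR.trans_le hRS) hS).continuousOn.mono hsub)
    rw [EventuallyEq, ae_restrict_iff' measurableSet_ball]
    filter_upwards [hGe R hR (hRS.trans_lt hS), hGe S (hR.trans_le hRS) hS] with z h1 h2 hz
    rw [← h1 hz, h2 (hsub hz)]
  -- The local solutions are continuous and agree a.e., hence everywhere, on common discs; any
  -- radius above `‖z‖` gives the same value.
  set g : ℂ → ℂ := fun z => G ((1 + ‖z‖) / 2) z with hg
  have hgG : ∀ R, 0 < R → R < 1 → EqOn g (G R) (Metric.ball 0 R) := by
    intro R hR0 hR1 z hz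
    have hzR : ‖z‖ < R := by simpa using hz
    have hz0 := norm_nonneg z
    rcases le_total ((1 + ‖z‖) / 2) R with hc | hc
    · exact hle _ _ (by linarith) hc hR1 (by simp; linarith)
    · exact (hle _ _ hR0 hc (by linarith) hz).symm
  refine ⟨g, fun z hz => ?_, ?_⟩
  · have hz1 : ‖z‖ < 1 := by simpa [disk] using hz
    have hz0 := norm_nonneg z
    have hzb : z ∈ Metric.ball (0 : ℂ) ((1 + ‖z‖) / 2) := by simp; linarith
    have hn := Metric.isOpen_ball.mem_nhds hzb
    exact (((hGd _ (by linarith) (by linarith)).differentiableAt hn).congr_of_eventuallyEq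
      (eventuallyEq_of_mem hn (hgG _ (by linarith) (by linarith)))).differentiableWithinAt
  -- Countably many radii exhaust the disk, so the exceptional sets unite to a null set.
  · have hn : ∀ n : ℕ, 0 < 1 - 1 / ((n : ℝ) + 2) ∧ 1 - 1 / ((n : ℝ) + 2) < 1 := by
      intro n
      have : (0 : ℝ) < (n : ℝ) + 2 := by positivity
      constructor
      · rw [sub_pos, div_lt_one this]; linarith [(n.cast_nonneg : (0 : ℝ) ≤ n)]
      · linarith [one_div_pos.2 this]
    have hall := ae_all_iff.2 fun n : ℕ => hGe _ (hn n).1 (hn n).2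
    filter_upwards [hall] with z hz hzd
    have hz1 : ‖z‖ < 1 := by simpa [disk] using hzd
    obtain ⟨n, hn'⟩ := exists_nat_one_div_lt (sub_pos.2 hz1)
    have hzb : z ∈ Metric.ball (0 : ℂ) (1 - 1 / ((n : ℝ) + 2)) := by
      have : 1 / ((n : ℝ) + 2) ≤ 1 / ((n : ℝ) + 1) :=
        one_div_le_one_div_of_le (by positivity) (by linarith)
      rw [mem_ball_zero_iff]
      linarith
    rw [hz n hzb, hgG _ (hn n).1 (hn n).2 hzb]

/-- A generalized solution of `∂w/∂z̄ = f` is the sum of a holomorphic function and the Cauchy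
transform of `f`. -/
theorem exists_eq_add_cauchyTransform {f w : ℂ → ℂ} (hw : IsDbarSolution f w)
    (hf : IntegrableOn f disk) :
    ∃ g : ℂ → ℂ, DifferentiableOn ℂ g disk ∧
      ∀ᵐ z, z ∈ disk → w z = g z + cauchyTransform f z := by
  have hC : LocallyIntegrableOn (cauchyTransform f) disk :=
    (integrableOn_cauchyTransform hf 1).locallyIntegrableOn
  have h0 : ∀ φ : ℂ → ℂ, ContDiff ℝ ∞ φ → HasCompactSupport φ → tsupport φ ⊆ disk →
      ∫ z in disk, (w - cauchyTransform f) z * dbar φ z = 0 := by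
    intro φ h hc ht
    have hs := (tsupport_dbar_subset φ).trans ht
    have hi1 := integrable_mul_of_tsupport_subset hw.1 (continuous_dbar h)
      (hasCompactSupport_dbar hc) hs
    have hi2 := integrable_mul_of_tsupport_subset hC (continuous_dbar h)
      (hasCompactSupport_dbar hc) hs
    simp only [Pi.sub_apply, sub_mul]
    rw [integral_sub hi1.integrableOn hi2.integrableOn, hw.2.2 φ h hc ht,
      setIntegral_disk_eq_integral (tsupport_mul_subset_of_right hs),
      integral_cauchyTransform_mul_dbar hf h hc, sub_self]
  obtain ⟨g, hg, he⟩ := exists_holomorphic_disk (hw.1.sub hC) h0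
  refine ⟨g, hg, he.mono fun z hz hzd => ?_⟩
  rw [← hz hzd]; simp

/-! ### The potential of `|f|` on circles -/

theorem intervalIntegrable_abs_rpow_neg {b : ℝ} (hb : b < 1) (c : ℝ) (hc : 0 ≤ c) :
    IntervalIntegrable (fun x : ℝ => |x| ^ (-b)) volume (-c) c := by
  have h1 : IntervalIntegrable (fun x : ℝ => |x| ^ (-b)) volume 0 c := by
    refine (intervalIntegral.intervalIntegrable_rpow' (r := -b) (by linarith)).congr ?_
    rw [uIoc_of_le hc]
    intro x hx
    simp [abs_of_pos hx.1]
  have h2 : IntervalIntegrable (fun x : ℝ => |x| ^ (-b)) volume (-c) 0 := by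
    have := ((IntervalIntegrable.iff_comp_neg (by simp)).1 h1).symm
    simpa using this
  exact h2.trans h1

theorem lintegral_Ioc_lt_top_of_intervalIntegrable {g : ℝ → ℝ≥0∞} {h : ℝ → ℝ} {a b : ℝ} (hab : a ≤ b)
    (hi : IntervalIntegrable h volume a b) (he : ∀ᵐ x, g x = ENNReal.ofReal (h x)) :
    ∫⁻ x in Ioc a b, g x < ⊤ := by
  rw [lintegral_congr_ae (ae_restrict_of_ae he)]
  exact ((intervalIntegrable_iff_integrableOn_Ioc_of_le hab).1 hi).lintegral_lt_top

theorem lintegral_abs_rpow_neg_lt_top {b : ℝ} (hb : b < 1) :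
    ∫⁻ x in Ioc (-1 : ℝ) 1, ENNReal.ofReal |x| ^ (-b) < ⊤ := by
  refine lintegral_Ioc_lt_top_of_intervalIntegrable (by norm_num)
    (intervalIntegrable_abs_rpow_neg hb 1 zero_le_one) ?_
  filter_upwards [Measure.ae_ne volume (0 : ℝ)] with x hx
  exact ENNReal.ofReal_rpow_of_pos (abs_pos.2 hx)

theorem ae_sin_ne_zero : ∀ᵐ x : ℝ, Real.sin x ≠ 0 := by
  have : {x : ℝ | ¬ Real.sin x ≠ 0} = range (fun n : ℤ => (n : ℝ) * Real.pi) := by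
    ext x; simp [Real.sin_eq_zero_iff]
  rw [ae_iff, this]
  exact (countable_range _).measure_zero _

/-- On `[-π/2, π/2]` one has `|sin x| ≥ (2/π)|x|`, and `|sin|` has period `π`. The interval `(-π,
3π]` contains every translate of `(0, 2π]` by minus an argument. -/
theorem lintegral_abs_sin_rpow_neg_lt_top {b : ℝ} (hb0 : 0 ≤ b) (hb : b < 1) :
    ∫⁻ x in Ioc (-Real.pi) (3 * Real.pi), ENNReal.ofReal |Real.sin x| ^ (-b) < ⊤ := by
  have hpi := Real.pi_pos
  have hper : Function.Periodic (fun x : ℝ => |Real.sin x| ^ (-b)) Real.pi := by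
    intro x; simp [Real.sin_add_pi]
  have hi : IntervalIntegrable (fun x : ℝ => |Real.sin x| ^ (-b)) volume (-(Real.pi / 2))
      (-(Real.pi / 2) + Real.pi) := by
    rw [show -(Real.pi / 2) + Real.pi = Real.pi / 2 by ring]
    have h1 := (intervalIntegrable_abs_rpow_neg hb (Real.pi / 2) (by positivity)).const_mul
      ((2 / Real.pi) ^ (-b))
    refine h1.mono_fun' ?_ ?_
    · exact Measurable.aestronglyMeasurable (by fun_prop)
    · rw [EventuallyLE, ae_restrict_iff' measurableSet_uIoc]
      filter_upwards [Measure.ae_ne volume (0 : ℝ)] with x hx hxI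
      rw [uIoc_of_le (by linarith)] at hxI
      have hle := Real.mul_abs_le_abs_sin (abs_le.2 ⟨hxI.1.le, hxI.2⟩)
      have hx' := abs_pos.2 hx
      rw [Real.norm_of_nonneg (by positivity), ← Real.mul_rpow (by positivity) (by positivity)]
      exact Real.rpow_le_rpow_of_nonpos (by positivity) hle (by linarith)
  refine lintegral_Ioc_lt_top_of_intervalIntegrable (by linarith)
    (hper.intervalIntegrable hpi.ne' hi _ _) ?_
  filter_upwards [ae_sin_ne_zero] with x hx
  exact ENNReal.ofReal_rpow_of_pos (abs_pos.2 hx)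

/-- Rotate `ζ` onto the positive axis and compare with the imaginary part. -/
theorem abs_sin_mul_le_norm_circleMap_sub (ζ : ℂ) {r : ℝ} (hr : 0 ≤ r) (θ : ℝ) :
    r * |Real.sin (θ - ζ.arg)| ≤ ‖circleMap 0 r θ - ζ‖ := by
  have h1 : ‖circleMap 0 r θ - ζ‖ =
      ‖(r : ℂ) * Complex.exp ((θ - ζ.arg : ℝ) * Complex.I) - ‖ζ‖‖ := by
    rw [← mul_one ‖_ - (‖ζ‖ : ℂ)‖, ← Complex.norm_exp_ofReal_mul_I ζ.arg, ← norm_mul, sub_mul,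
      mul_assoc, ← Complex.exp_add, Complex.norm_mul_exp_arg_mul_I]
    simp only [circleMap, zero_add]
    congr 4; push_cast; ring_nf
  rw [h1]
  refine le_trans (le_of_eq ?_) (Complex.abs_im_le_norm _)
  rw [Complex.sub_im, Complex.ofReal_im, sub_zero, Complex.im_ofReal_mul,
    Complex.exp_ofReal_mul_I_im, abs_mul, abs_of_nonneg hr]

theorem abs_norm_sub_le_norm_circleMap_sub (ζ : ℂ) {r : ℝ} (hr : 0 ≤ r) (θ : ℝ) :
    |‖ζ‖ - r| ≤ ‖circleMap 0 r θ - ζ‖ := by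
  have := abs_norm_sub_norm_le ζ (circleMap 0 r θ)
  rwa [norm_circleMap_zero, abs_of_nonneg hr, norm_sub_rev] at this

theorem ennreal_inv_eq_rpow_mul_rpow (x : ℝ≥0∞) {a : ℝ} (ha0 : 0 < a) (ha1 : a < 1) :
    x⁻¹ = x ^ (-a) * x ^ (-(1 - a)) := by
  rw [ENNReal.rpow_neg, ENNReal.rpow_neg]
  rcases eq_or_ne x 0 with rfl | h0
  · simp [ha0, ha1]
  rcases eq_or_ne x ⊤ with rfl | h1
  · simp [ha0, ha1]
  rw [← ENNReal.rpow_neg, ← ENNReal.rpow_neg, ← ENNReal.rpow_add _ _ h0 h1]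
  ring_nf
  exact (ENNReal.rpow_neg_one x).symm

theorem ennreal_rpow_neg_le_rpow_neg {x y : ℝ≥0∞} (h : x ≤ y) {a : ℝ} (ha : 0 ≤ a) :
    y ^ (-a) ≤ x ^ (-a) := by
  rw [ENNReal.rpow_neg, ENNReal.rpow_neg]
  exact ENNReal.inv_le_inv.2 (ENNReal.rpow_le_rpow h ha)

/-- At `|ζ| = r` the kernel is not integrable along the circle. Interpolating between the radial
bound `|z-ζ| ≥ ||ζ|-r|` with exponent `a` and the angular bound `|z-ζ| ≥ r|sin(θ - arg ζ)|` with
exponent `1 - a < 1` leaves a convergent angular integral and a mild radial singularity. -/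
theorem lintegral_circle_enorm_inv_le (ζ : ℂ) {r : ℝ} (hr0 : 0 < r) (hr1 : r < 1) {a : ℝ}
    (ha0 : 0 < a) (ha1 : a < 1) :
    ∫⁻ θ in Ioc 0 (2 * Real.pi), ‖circleMap 0 r θ - ζ‖ₑ⁻¹ ≤
      ENNReal.ofReal |‖ζ‖ - r| ^ (-a) * ((ENNReal.ofReal r)⁻¹ *
        ∫⁻ x in Ioc (-Real.pi) (3 * Real.pi), ENNReal.ofReal |Real.sin x| ^ (-(1 - a))) := by
  have hpt : ∀ θ : ℝ, ‖circleMap 0 r θ - ζ‖ₑ⁻¹ ≤ ENNReal.ofReal |‖ζ‖ - r| ^ (-a) *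
      ((ENNReal.ofReal r)⁻¹ * ENNReal.ofReal |Real.sin (θ - ζ.arg)| ^ (-(1 - a))) := by
    intro θ
    rw [ennreal_inv_eq_rpow_mul_rpow _ ha0 ha1]
    gcongr ?_ * ?_
    · refine ennreal_rpow_neg_le_rpow_neg ?_ ha0.le
      rw [← ofReal_norm]
      exact ENNReal.ofReal_le_ofReal (abs_norm_sub_le_norm_circleMap_sub ζ hr0.le θ)
    · have h1 : ENNReal.ofReal r * ENNReal.ofReal |Real.sin (θ - ζ.arg)| ≤
          ‖circleMap 0 r θ - ζ‖ₑ := by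
        rw [← ENNReal.ofReal_mul hr0.le, ← ofReal_norm]
        exact ENNReal.ofReal_le_ofReal (abs_sin_mul_le_norm_circleMap_sub ζ hr0.le θ)
      refine (ennreal_rpow_neg_le_rpow_neg h1 (by linarith)).trans ?_
      have hr0' : ENNReal.ofReal r ≠ 0 := by simpa using hr0
      have hsplit : (ENNReal.ofReal r * ENNReal.ofReal |Real.sin (θ - ζ.arg)|) ^ (-(1 - a)) =
          ENNReal.ofReal r ^ (-(1 - a)) * ENNReal.ofReal |Real.sin (θ - ζ.arg)| ^ (-(1 - a)) :=
        ENNReal.mul_rpow_of_ne_top ENNReal.ofReal_ne_top ENNReal.ofReal_ne_top _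
      rw [hsplit]
      gcongr
      -- Since `r < 1`, `r^{-(1-a)} ≤ r⁻¹`.
      rw [ENNReal.rpow_neg, ENNReal.inv_le_inv]
      calc ENNReal.ofReal r = ENNReal.ofReal r ^ (1 : ℝ) := (ENNReal.rpow_one _).symm
        _ ≤ _ := ENNReal.rpow_le_rpow_of_exponent_ge
          (ENNReal.ofReal_le_one.2 hr1.le) (by linarith)
  refine (lintegral_mono hpt).trans ?_
  rw [lintegral_const_mul _ (by fun_prop), lintegral_const_mul _ (by fun_prop)]
  refine mul_le_mul' le_rfl (mul_le_mul' le_rfl ?_)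
  rw [← lintegral_indicator measurableSet_Ioc, ← lintegral_indicator measurableSet_Ioc,
    ← lintegral_sub_right_eq_self
      (fun x => (Ioc (-Real.pi) (3 * Real.pi)).indicator _ x) ζ.arg]
  refine lintegral_mono fun θ => ?_
  by_cases h : θ ∈ Ioc 0 (2 * Real.pi)
  · rw [indicator_of_mem h, indicator_of_mem]
    have h1 := Complex.arg_le_pi ζ
    have h2 := Complex.neg_pi_lt_arg ζ
    exact ⟨by linarith [h.1], by linarith [h.2]⟩
  · rw [indicator_of_notMem h]; exact zero_le

theorem lintegral_disk_abs_rpow_neg_le {r : ℝ} (hr0 : 0 < r) (hr1 : r < 1) (c : ℝ) :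
    ∫⁻ ζ in disk, ENNReal.ofReal |‖ζ‖ - r| ^ (-c) ≤
      ENNReal.ofReal (2 * Real.pi) * ∫⁻ x in Ioc (-1 : ℝ) 1, ENNReal.ofReal |x| ^ (-c) := by
  rw [disk, setLIntegral_norm_ball (fun x => ENNReal.ofReal |x - r| ^ (-c)) (by fun_prop)]
  refine mul_le_mul' le_rfl ?_
  rw [← lintegral_indicator measurableSet_Ioo, ← lintegral_indicator measurableSet_Ioc,
    ← lintegral_sub_right_eq_self (fun x => (Ioc (-1 : ℝ) 1).indicator _ x) r]
  refine lintegral_mono fun θ => ?_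
  by_cases h : θ ∈ Ioo (0 : ℝ) 1
  · have h' : θ - r ∈ Ioc (-1 : ℝ) 1 := ⟨by linarith [h.1], by linarith [h.2]⟩
    rw [indicator_of_mem h, indicator_of_mem h']
    refine mul_le_of_le_one_left' ?_
    exact ENNReal.ofReal_le_one.2 h.2.le
  · rw [indicator_of_notMem h]; exact zero_le

/-- The potential `∬_D |f(ζ)| / |z - ζ|`. -/
noncomputable def potential (f : ℂ → ℂ) (z : ℂ) : ℝ≥0∞ :=
  ∫⁻ ζ in disk, ‖f ζ‖ₑ * ‖z - ζ‖ₑ⁻¹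

instance isFiniteMeasure_restrict_disk : IsFiniteMeasure ((volume : Measure ℂ).restrict disk) :=
  ⟨by simp [disk]⟩

/-- After Tonelli, the previous interpolation leaves `∬_D |f(ζ)| ||ζ|-r|^{-a}`, which Hölder's
inequality bounds uniformly in `r` once `a` is small compared with the conjugate exponent. -/
theorem exists_lintegral_potential_circle_le {f : ℂ → ℂ} {q : ℝ≥0∞} (hq : 1 < q)
    (hf : MemLp f q (volume.restrict disk)) :
    ∃ C : ℝ≥0∞, C ≠ ⊤ ∧ ∀ r ∈ Ioo (0 : ℝ) 1,
      ∫⁻ θ in Ioc 0 (2 * Real.pi), potential f (circleMap 0 r θ) ≤ (ENNReal.ofReal r)⁻¹ * C := by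
  -- `D` has finite measure, so `q` may be lowered to a finite exponent that is still greater than
  -- 1.
  have hq2 : min q 2 ≠ ⊤ := ((min_le_right _ _).trans_lt (by simp)).ne
  have hq1 : 1 < min q 2 := lt_min hq (by norm_num)
  set t := (min q 2).toReal with ht
  have ht1 : 1 < t := by
    have := (ENNReal.toReal_lt_toReal ENNReal.one_ne_top hq2).2 hq1
    simpa using this
  have hft : ∫⁻ ζ in disk, ‖f ζ‖ₑ ^ t < ⊤ :=
    lintegral_rpow_enorm_lt_top_of_eLpNorm_lt_top (zero_lt_one.trans hq1).ne' hq2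
      (hf.mono_exponent (min_le_left _ _)).2
  set s := t.conjExponent with hs
  have hts : t.HolderConjugate s := Real.HolderConjugate.conjExponent ht1
  have hs1 : 1 < s := hts.symm.lt
  -- With this choice the `s`-th power of the radial factor is `||ζ|-r|^{-1/2}`, which is
  -- integrable.
  set a := 1 / (2 * s) with ha
  have ha0 : 0 < a := by positivity
  have ha1 : a < 1 := by
    rw [ha, div_lt_one (by positivity)]; linarith
  have has : -a * s = -(1 / 2) := by rw [ha]; field_simp
  set S := ∫⁻ x in Ioc (-Real.pi) (3 * Real.pi), ENNReal.ofReal |Real.sin x| ^ (-(1 - a))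
  have hS : S < ⊤ := lintegral_abs_sin_rpow_neg_lt_top (by linarith) (by linarith)
  set J := ENNReal.ofReal (2 * Real.pi) *
    ∫⁻ x in Ioc (-1 : ℝ) 1, ENNReal.ofReal |x| ^ (-(1 / 2 : ℝ))
  have hJ : J < ⊤ := ENNReal.mul_lt_top ENNReal.ofReal_lt_top
    (lintegral_abs_rpow_neg_lt_top (by norm_num))
  refine ⟨((∫⁻ ζ in disk, ‖f ζ‖ₑ ^ t) ^ (1 / t) * J ^ (1 / s)) * S, ?_, ?_⟩
  · refine ENNReal.mul_ne_top (ENNReal.mul_ne_top ?_ ?_) hS.ne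
    · exact ENNReal.rpow_ne_top_of_nonneg (by positivity) hft.ne
    · exact ENNReal.rpow_ne_top_of_nonneg (by positivity) hJ.ne
  rintro r ⟨hr0, hr1⟩
  have hfm : AEMeasurable (fun ζ => ‖f ζ‖ₑ) (volume.restrict disk) := hf.1.enorm
  have hm : AEMeasurable (fun p : ℝ × ℂ => ‖f p.2‖ₑ * ‖circleMap 0 r p.1 - p.2‖ₑ⁻¹)
      ((volume.restrict (Ioc 0 (2 * Real.pi))).prod (volume.restrict disk)) := by
    refine hf.1.comp_snd.enorm.mul (Measurable.aemeasurable ?_)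
    have : Continuous fun p : ℝ × ℂ => circleMap 0 r p.1 - p.2 := by
      unfold circleMap; fun_prop
    exact this.measurable.enorm.inv
  calc ∫⁻ θ in Ioc 0 (2 * Real.pi), potential f (circleMap 0 r θ)
      = ∫⁻ ζ in disk, ∫⁻ θ in Ioc 0 (2 * Real.pi), ‖f ζ‖ₑ * ‖circleMap 0 r θ - ζ‖ₑ⁻¹ :=
        lintegral_lintegral_swap hm
    _ ≤ ∫⁻ ζ in disk, (‖f ζ‖ₑ * ENNReal.ofReal |‖ζ‖ - r| ^ (-a)) *
          ((ENNReal.ofReal r)⁻¹ * S) := by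
        refine lintegral_mono fun ζ => ?_
        have hcm : Measurable fun θ : ℝ => ‖circleMap 0 r θ - ζ‖ₑ⁻¹ := by
          have : Continuous fun θ : ℝ => circleMap 0 r θ - ζ := by unfold circleMap; fun_prop
          exact this.measurable.enorm.inv
        simp only
        rw [lintegral_const_mul _ hcm, mul_assoc]
        gcongr
        exact lintegral_circle_enorm_inv_le ζ hr0 hr1 ha0 ha1
    _ = (∫⁻ ζ in disk, ‖f ζ‖ₑ * ENNReal.ofReal |‖ζ‖ - r| ^ (-a)) *
          ((ENNReal.ofReal r)⁻¹ * S) := lintegral_mul_const'' _ (hfm.mul (by fun_prop))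
    _ ≤ ((∫⁻ ζ in disk, ‖f ζ‖ₑ ^ t) ^ (1 / t) * J ^ (1 / s)) *
          ((ENNReal.ofReal r)⁻¹ * S) := by
        gcongr
        refine (ENNReal.lintegral_mul_le_Lp_mul_Lq _ hts hfm (g := fun ζ =>
          ENNReal.ofReal |‖ζ‖ - r| ^ (-a)) (by fun_prop)).trans ?_
        gcongr
        simp only [← ENNReal.rpow_mul, has]
        exact lintegral_disk_abs_rpow_neg_le hr0 hr1 _
    _ = _ := by ring

/-! ### The modified kernel and its holomorphic reflected part -/

theorem mem_disk {z : ℂ} : z ∈ disk ↔ ‖z‖ < 1 := by simp [disk]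

/-- This rests on `|1 - ζ̄z|² - |z - ζ|² = (1 - |z|²)(1 - |ζ|²)`. It makes the Cauchy kernel
dominate the reflected one, so a single potential controls both. -/
theorem norm_sub_le_norm_one_sub_conj_mul {z ζ : ℂ} (hz : z ∈ disk) (hζ : ζ ∈ disk) :
    ‖z - ζ‖ ≤ ‖1 - conj ζ * z‖ := by
  rw [mem_disk] at hz hζ
  have h1 : ‖z‖ ^ 2 ≤ 1 := pow_le_one₀ (norm_nonneg _) hz.le
  have h2 : ‖ζ‖ ^ 2 ≤ 1 := pow_le_one₀ (norm_nonneg _) hζ.le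
  refine le_of_sq_le_sq ?_ (norm_nonneg _)
  rw [Complex.sq_norm, Complex.normSq_apply] at h1 h2 ⊢
  rw [Complex.sq_norm, Complex.normSq_apply]
  simp only [Complex.sub_re, Complex.sub_im, Complex.one_re, Complex.one_im, Complex.mul_re,
    Complex.mul_im, Complex.conj_re, Complex.conj_im]
  nlinarith [mul_nonneg (sub_nonneg.2 h1) (sub_nonneg.2 h2)]

theorem one_sub_norm_le_norm_one_sub_conj_mul {z ζ : ℂ} (hζ : ζ ∈ disk) :
    1 - ‖z‖ ≤ ‖1 - conj ζ * z‖ := by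
  rw [mem_disk] at hζ
  have h1 : ‖conj ζ * z‖ ≤ ‖z‖ := by
    rw [norm_mul, RCLike.norm_conj]
    exact mul_le_of_le_one_left (norm_nonneg _) hζ.le
  have h2 := norm_sub_norm_le (1 : ℂ) (conj ζ * z)
  rw [norm_one] at h2
  linarith

theorem enorm_modifiedIntegrand_le (f : ℂ → ℂ) {z ζ : ℂ} (hz : z ∈ disk) (hζ : ζ ∈ disk) :
    ‖modifiedIntegrand f z ζ‖ₑ ≤ 2 * (‖f ζ‖ₑ * ‖z - ζ‖ₑ⁻¹) := by
  have h1 : ‖f ζ / (ζ - z)‖ₑ ≤ ‖f ζ‖ₑ * ‖z - ζ‖ₑ⁻¹ := by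
    rw [div_eq_mul_inv, enorm_mul, enorm_sub_rev z]
    gcongr
    exact enorm_inv_le_inv_enorm _
  have h2 : ‖z * conj (f ζ) / (1 - conj ζ * z)‖ₑ ≤ ‖f ζ‖ₑ * ‖z - ζ‖ₑ⁻¹ := by
    rw [div_eq_mul_inv, enorm_mul, enorm_mul]
    have hz1 : ‖z‖ₑ ≤ 1 := by
      rw [← ofReal_norm]; exact ENNReal.ofReal_le_one.2 (mem_disk.1 hz).le
    have hc : ‖conj (f ζ)‖ₑ = ‖f ζ‖ₑ := by
      rw [← ofReal_norm, RCLike.norm_conj, ofReal_norm]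
    rw [hc]
    have h3 : ‖(1 - conj ζ * z)⁻¹‖ₑ ≤ ‖z - ζ‖ₑ⁻¹ := by
      refine (enorm_inv_le_inv_enorm _).trans (ENNReal.inv_le_inv.2 ?_)
      rw [← ofReal_norm, ← ofReal_norm]
      exact ENNReal.ofReal_le_ofReal (norm_sub_le_norm_one_sub_conj_mul hz hζ)
    calc ‖z‖ₑ * ‖f ζ‖ₑ * ‖(1 - conj ζ * z)⁻¹‖ₑ ≤ 1 * ‖f ζ‖ₑ * ‖z - ζ‖ₑ⁻¹ := by gcongr
      _ = _ := by rw [one_mul]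
  rw [two_mul]
  exact (enorm_add_le _ _).trans (add_le_add h1 h2)

theorem lintegral_modifiedIntegrand_le (f : ℂ → ℂ) {z : ℂ} (hz : z ∈ disk) :
    ∫⁻ ζ in disk, ‖modifiedIntegrand f z ζ‖ₑ ≤ 2 * potential f z := by
  rw [potential, ← lintegral_const_mul' _ _ (by simp)]
  exact setLIntegral_mono' measurableSet_ball fun ζ hζ => enorm_modifiedIntegrand_le f hz hζ

theorem aestronglyMeasurable_modifiedIntegrand {f : ℂ → ℂ} (hf : IntegrableOn f disk) (z : ℂ) :
    AEStronglyMeasurable (modifiedIntegrand f z) (volume.restrict disk) := by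
  have h1 : AEStronglyMeasurable (fun ζ : ℂ => (ζ - z)⁻¹) (volume.restrict disk) :=
    Measurable.aestronglyMeasurable (by fun_prop)
  have h2 : AEStronglyMeasurable (fun ζ : ℂ => (1 - conj ζ * z)⁻¹) (volume.restrict disk) := by
    have : Continuous fun ζ : ℂ => 1 - conj ζ * z := by fun_prop
    exact this.measurable.inv.aestronglyMeasurable
  have h3 : AEStronglyMeasurable (fun ζ => conj (f ζ)) (volume.restrict disk) :=
    Complex.continuous_conj.comp_aestronglyMeasurable hf.1
  unfold modifiedIntegrand
  simp only [div_eq_mul_inv]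
  exact (hf.1.mul h1).add ((aestronglyMeasurable_const.mul h3).mul h2)

theorem modifiedDefinedAt_of_potential_lt_top {f : ℂ → ℂ} (hf : IntegrableOn f disk) {z : ℂ}
    (hz : z ∈ disk) (h : potential f z < ⊤) : ModifiedDefinedAt f z :=
  ⟨aestronglyMeasurable_modifiedIntegrand hf z, by
    rw [hasFiniteIntegral_iff_enorm]
    exact (lintegral_modifiedIntegrand_le f hz).trans_lt (ENNReal.mul_lt_top (by simp) h)⟩

/-- The reflected, holomorphic part of the modified operator. -/
noncomputable def reflectedTransform (f : ℂ → ℂ) (z : ℂ) : ℂ :=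
  -(1 / (Real.pi : ℂ)) * ∫ ζ in disk, z * conj (f ζ) / (1 - conj ζ * z)

theorem integrableOn_conj {f : ℂ → ℂ} (hf : IntegrableOn f disk) :
    IntegrableOn (fun ζ => conj (f ζ)) disk :=
  Complex.conjLIE.toContinuousLinearEquiv.toContinuousLinearMap.integrable_comp hf

theorem aestronglyMeasurable_one_sub_conj_mul_inv (z : ℂ) :
    AEStronglyMeasurable (fun ζ : ℂ => (1 - conj ζ * z)⁻¹) (volume.restrict disk) := by
  have : Continuous fun ζ : ℂ => 1 - conj ζ * z := by fun_prop
  exact this.measurable.inv.aestronglyMeasurable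

theorem integrableOn_conj_mul_inv {f : ℂ → ℂ} (hf : IntegrableOn f disk) {z : ℂ}
    (hz : z ∈ disk) : IntegrableOn (fun ζ => conj (f ζ) * (1 - conj ζ * z)⁻¹) disk := by
  have h1 : 0 < 1 - ‖z‖ := sub_pos.2 (mem_disk.1 hz)
  have hc := integrableOn_conj hf
  refine (hc.norm.mul_const (1 - ‖z‖)⁻¹).mono'
    (hc.1.mul (aestronglyMeasurable_one_sub_conj_mul_inv z)) ?_
  refine (ae_restrict_mem measurableSet_ball).mono fun ζ hζ => ?_
  rw [norm_mul, norm_inv]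
  gcongr
  exact one_sub_norm_le_norm_one_sub_conj_mul hζ

theorem potential_lt_top_of_integrableOn {f : ℂ → ℂ} {z : ℂ}
    (h : IntegrableOn (fun ζ => f ζ * (z - ζ)⁻¹) disk) : potential f z < ⊤ := by
  have h2 := h.2
  rw [hasFiniteIntegral_iff_enorm] at h2
  refine lt_of_le_of_lt (lintegral_mono_ae ?_) h2
  filter_upwards [ae_restrict_of_ae (Measure.ae_ne volume z)] with ζ hζ
  rw [enorm_mul, enorm_inv (sub_ne_zero.2 hζ.symm)]

/-- For fixed `z` in `D` the reflected kernel is bounded, so subtracting the reflected term leaves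
the Cauchy integrand absolutely integrable. -/
theorem potential_lt_top_of_modifiedDefinedAt {f : ℂ → ℂ} (hf : IntegrableOn f disk) {z : ℂ}
    (hz : z ∈ disk) (h : ModifiedDefinedAt f z) : potential f z < ⊤ := by
  refine potential_lt_top_of_integrableOn
    ((h.sub ((integrableOn_conj_mul_inv hf hz).const_mul z)).neg.congr
      (Eventually.of_forall fun ζ => ?_))
  simp only [Pi.neg_apply, Pi.sub_apply, modifiedIntegrand]
  rw [mul_div_assoc, div_eq_mul_inv (conj (f ζ)), add_sub_cancel_right, div_eq_mul_inv,
    ← mul_neg, ← inv_neg, neg_sub]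

theorem modifiedT_eq_add {f : ℂ → ℂ} (hf : IntegrableOn f disk) {z : ℂ}
    (hz : z ∈ disk) (h : ModifiedDefinedAt f z) :
    modifiedT f z = cauchyTransform f z + reflectedTransform f z := by
  have hr : IntegrableOn (fun ζ => z * conj (f ζ) / (1 - conj ζ * z)) disk := by
    refine ((integrableOn_conj_mul_inv hf hz).const_mul z).congr (Eventually.of_forall fun ζ => ?_)
    ring_nf
  have h1 : IntegrableOn (fun ζ => f ζ / (ζ - z)) disk :=
    (h.sub hr).congr (Eventually.of_forall fun ζ => by
      simp only [Pi.sub_apply, modifiedIntegrand]; ring)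
  simp only [modifiedT, cauchyTransform, reflectedTransform, modifiedIntegrand]
  rw [integral_add h1 hr]
  have : ∀ ζ, f ζ * (z - ζ)⁻¹ = -(f ζ / (ζ - z)) := fun ζ => by
    rw [← neg_sub, inv_neg, div_eq_mul_inv]; ring
  simp only [this, integral_neg]
  ring

theorem enorm_modifiedT_le (f : ℂ → ℂ) {z : ℂ} (hz : z ∈ disk) :
    ‖modifiedT f z‖ₑ ≤ potential f z := by
  -- The two kernel terms cost a factor 2, which `1/π` absorbs. Where the integral diverges, the
  -- default value 0 satisfies the bound trivially.
  have hpi : ‖(-(1 / (Real.pi : ℂ)))‖ₑ * 2 ≤ 1 := by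
    rw [← ofReal_norm, norm_neg, norm_div, norm_one, Complex.norm_real,
      Real.norm_of_nonneg Real.pi_pos.le, ← ENNReal.ofReal_ofNat, ← ENNReal.ofReal_mul (by positivity)]
    refine ENNReal.ofReal_le_one.2 ?_
    rw [div_mul_eq_mul_div, one_mul, div_le_one Real.pi_pos]
    exact Real.two_le_pi
  rw [modifiedT, enorm_mul]
  calc _ ≤ ‖(-(1 / (Real.pi : ℂ)))‖ₑ * (2 * potential f z) := by
        gcongr
        exact (enorm_integral_le_lintegral_enorm _).trans (lintegral_modifiedIntegrand_le f hz)
    _ = (‖(-(1 / (Real.pi : ℂ)))‖ₑ * 2) * potential f z := by ring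
    _ ≤ 1 * potential f z := by gcongr
    _ = _ := one_mul _

theorem differentiableOn_reflectedTransform {f : ℂ → ℂ} (hf : IntegrableOn f disk) :
    DifferentiableOn ℂ (reflectedTransform f) disk := by
  intro z hz
  have hz1 := mem_disk.1 hz
  set δ := (1 - ‖z‖) / 2 with hδ
  have hδ0 : 0 < δ := by linarith
  have hc := integrableOn_conj hf
  have hbd : ∀ x ∈ Metric.ball z δ, ∀ ζ ∈ disk, δ ≤ ‖1 - conj ζ * x‖ := by
    intro x hx ζ hζ
    refine le_trans ?_ (one_sub_norm_le_norm_one_sub_conj_mul hζ)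
    have := norm_sub_norm_le x z
    rw [Metric.mem_ball, dist_eq_norm] at hx
    linarith
  have key := hasDerivAt_integral_of_dominated_loc_of_deriv_le (𝕜 := ℂ)
    (μ := volume.restrict disk) (F := fun x ζ => conj (f ζ) * (1 - conj ζ * x)⁻¹) (x₀ := z)
    (s := Metric.ball z δ) (bound := fun ζ => ‖conj (f ζ)‖ * (δ ^ 2)⁻¹)
    (F' := fun x ζ => conj (f ζ) * (conj ζ * ((1 - conj ζ * x) ^ 2)⁻¹))
    (Metric.ball_mem_nhds _ hδ0)
    (Eventually.of_forall fun x => hc.1.mul (aestronglyMeasurable_one_sub_conj_mul_inv x))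
    (integrableOn_conj_mul_inv hf hz) ?_ ?_ (hc.norm.mul_const _) ?_
  · have e : reflectedTransform f = fun z => -(1 / (Real.pi : ℂ)) *
        (z * ∫ ζ in disk, conj (f ζ) * (1 - conj ζ * z)⁻¹) := by
      ext x
      rw [reflectedTransform, ← integral_const_mul x]
      refine congrArg _ (integral_congr_ae (Eventually.of_forall fun ζ => ?_))
      ring
    rw [e]
    exact ((differentiableAt_id.mul key.2.differentiableAt).const_mul _).differentiableWithinAt
  · refine hc.1.mul ?_
    have : Continuous fun ζ : ℂ => 1 - conj ζ * z := by fun_prop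
    exact ((Complex.continuous_conj.measurable).mul
      (this.measurable.pow_const 2).inv).aestronglyMeasurable
  · refine (ae_restrict_mem measurableSet_ball).mono fun ζ hζ x hx => ?_
    rw [norm_mul, norm_mul, norm_inv, norm_pow]
    have h1 : ‖conj ζ‖ ≤ 1 := by rw [RCLike.norm_conj]; exact (mem_disk.1 hζ).le
    calc _ ≤ ‖conj (f ζ)‖ * (1 * (δ ^ 2)⁻¹) := by
          gcongr
          exact hbd x hx ζ hζ
      _ = _ := by rw [one_mul]
  · refine (ae_restrict_mem measurableSet_ball).mono fun ζ hζ x hx => ?_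
    have hne : 1 - conj ζ * x ≠ 0 := norm_pos_iff.1 (hδ0.trans_le (hbd x hx ζ hζ))
    have := ((((hasDerivAt_id x).const_mul (conj ζ)).const_sub 1).inv hne).const_mul (conj (f ζ))
    refine this.congr_deriv ?_
    simp [div_eq_mul_inv]

/-! ### Lebesgue values of the Cauchy transform -/

theorem hasLebesgueValue_of_tendsto {w : ℂ → ℂ} {z c : ℂ}
    (h : Tendsto (fun ρ : ℝ => (volume (Metric.ball z ρ))⁻¹ *
      ∫⁻ ζ in Metric.ball z ρ, ‖w ζ - c‖ₑ) (𝓝[>] 0) (𝓝 0)) : HasLebesgueValue w z c := by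
  have h' := (ENNReal.tendsto_toReal ENNReal.zero_ne_top).comp h
  rw [ENNReal.toReal_zero] at h'
  refine squeeze_zero (fun ρ => ?_) (fun ρ => ?_) h'
  · rw [setAverage_eq]
    exact smul_nonneg (by positivity) (integral_nonneg fun _ => norm_nonneg _)
  · rw [setAverage_eq, smul_eq_mul]
    simp only [Function.comp, ENNReal.toReal_mul, ENNReal.toReal_inv]
    gcongr ?_ * ?_
    · exact le_rfl
    -- Measurability of `w` is not assumed: if the norm is not integrable, its Bochner integral is 0
    -- by convention and the inequality still holds.
    · by_cases hm : AEStronglyMeasurable (fun ζ => w ζ - c) (volume.restrict (Metric.ball z ρ))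
      · exact (integral_norm_eq_lintegral_enorm hm).le
      · by_cases hi : Integrable (fun ζ => ‖w ζ - c‖) (volume.restrict (Metric.ball z ρ))
        · rw [integral_eq_lintegral_of_nonneg_ae (Eventually.of_forall fun _ => norm_nonneg _) hi.1]
          simp only [ofReal_norm]; exact le_rfl
        · rw [integral_undef hi]; exact ENNReal.toReal_nonneg

theorem tendsto_average_of_continuousAt {g : ℂ → ℂ} {z : ℂ} (hg : ContinuousAt g z) :
    Tendsto (fun ρ : ℝ => (volume (Metric.ball z ρ))⁻¹ *
      ∫⁻ ζ in Metric.ball z ρ, ‖g ζ - g z‖ₑ) (𝓝[>] 0) (𝓝 0) := by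
  rw [ENNReal.tendsto_nhds_zero]
  intro ε hε
  have h1 : ∀ᶠ ζ in 𝓝 z, ‖g ζ - g z‖ₑ ≤ ε := by
    have : Tendsto (fun ζ => ‖g ζ - g z‖ₑ) (𝓝 z) (𝓝 0) := by
      have h2 : Tendsto (fun ζ => g ζ - g z) (𝓝 z) (𝓝 0) := by
        simpa using hg.tendsto.sub_const (g z)
      simpa [Function.comp_def] using (continuous_enorm.tendsto (0 : ℂ)).comp h2
    exact (ENNReal.tendsto_nhds_zero.1 this) ε hε
  obtain ⟨δ, hδ, hsub⟩ := Metric.eventually_nhds_iff_ball.1 h1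
  filter_upwards [Ioo_mem_nhdsGT hδ] with ρ hρ
  have hv0 : volume (Metric.ball z ρ) ≠ 0 := (Metric.measure_ball_pos _ _ hρ.1).ne'
  calc _ ≤ (volume (Metric.ball z ρ))⁻¹ * ∫⁻ ζ in Metric.ball z ρ, ε := by
        refine mul_le_mul' le_rfl ?_
        exact setLIntegral_mono' measurableSet_ball fun ζ hζ =>
          hsub ζ (Metric.ball_subset_ball hρ.2.le hζ)
    _ = ε := by
        rw [setLIntegral_const, mul_comm ε, ← mul_assoc,
          ENNReal.inv_mul_cancel hv0 measure_ball_lt_top.ne, one_mul]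

/-- Split at `|x - ζ| = ρ`: outside, the integrand is at most `1/ρ`; inside, the integral is at most
`2πρ`, which contributes `2/ρ` after division by `πρ²`. -/
theorem average_enorm_inv_le (z ζ : ℂ) {ρ : ℝ} (hρ : 0 < ρ) :
    (volume (Metric.ball z ρ))⁻¹ * ∫⁻ x in Metric.ball z ρ, ‖x - ζ‖ₑ⁻¹ ≤
      3 * (ENNReal.ofReal ρ)⁻¹ := by
  have hρ' : ENNReal.ofReal ρ ≠ 0 := by simpa using hρ
  have hv0 : volume (Metric.ball z ρ) ≠ 0 := (Metric.measure_ball_pos _ _ hρ).ne'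
  have hv : volume (Metric.ball z ρ) = ENNReal.ofReal Real.pi * ENNReal.ofReal ρ ^ 2 := by
    rw [Complex.volume_ball, mul_comm, ← NNReal.coe_real_pi, ENNReal.ofReal_coe_nnreal]
  have hpt : ∀ x : ℂ, ‖x - ζ‖ₑ⁻¹ ≤ (ENNReal.ofReal ρ)⁻¹ +
      (Metric.ball ζ ρ).indicator (fun x => ‖x - ζ‖ₑ⁻¹) x := by
    intro x
    by_cases h : x ∈ Metric.ball ζ ρ
    · rw [indicator_of_mem h]; exact le_add_self
    · rw [indicator_of_notMem h, add_zero, ENNReal.inv_le_inv, ← ofReal_norm]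
      refine ENNReal.ofReal_le_ofReal ?_
      rwa [Metric.mem_ball, dist_eq_norm, not_lt] at h
  have hI : ∫⁻ x in Metric.ball z ρ, (Metric.ball ζ ρ).indicator (fun x => ‖x - ζ‖ₑ⁻¹) x ≤
      2 * (ENNReal.ofReal Real.pi * ENNReal.ofReal ρ) := by
    refine (setLIntegral_le_lintegral _ _).trans ?_
    rw [lintegral_indicator measurableSet_ball, setLIntegral_enorm_sub_inv_ball,
      ENNReal.ofReal_mul (by norm_num), mul_assoc]
    simp
  have he : ENNReal.ofReal Real.pi * ENNReal.ofReal ρ =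
      volume (Metric.ball z ρ) * (ENNReal.ofReal ρ)⁻¹ := by
    rw [hv, sq, mul_assoc, mul_assoc, ENNReal.mul_inv_cancel hρ' ENNReal.ofReal_ne_top, mul_one]
  calc (volume (Metric.ball z ρ))⁻¹ * ∫⁻ x in Metric.ball z ρ, ‖x - ζ‖ₑ⁻¹
      ≤ (volume (Metric.ball z ρ))⁻¹ * (volume (Metric.ball z ρ) * (ENNReal.ofReal ρ)⁻¹ +
          2 * (volume (Metric.ball z ρ) * (ENNReal.ofReal ρ)⁻¹)) := by
        gcongr
        refine (lintegral_mono hpt).trans ?_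
        rw [lintegral_add_left measurable_const, setLIntegral_const,
          mul_comm (ENNReal.ofReal ρ)⁻¹, ← he]
        exact add_le_add le_rfl hI
    _ = (volume (Metric.ball z ρ))⁻¹ * volume (Metric.ball z ρ) *
          (3 * (ENNReal.ofReal ρ)⁻¹) := by ring
    _ = _ := by rw [ENNReal.inv_mul_cancel hv0 measure_ball_lt_top.ne, one_mul]

/-- From `|z-ζ| ≤ |x-ζ| + ρ`, the mean of `|z-ζ|/|x-ζ|` is at most `1 + ρ · 3/ρ = 4`. Uniformity in
`ρ` supplies the majorant for the Lebesgue point argument. -/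
theorem average_enorm_inv_le_inv (z ζ : ℂ) {ρ : ℝ} (hρ : 0 < ρ) :
    (volume (Metric.ball z ρ))⁻¹ * ∫⁻ x in Metric.ball z ρ, ‖x - ζ‖ₑ⁻¹ ≤ 4 * ‖z - ζ‖ₑ⁻¹ := by
  rcases eq_or_ne z ζ with rfl | hne
  · simp
  have hρ' : ENNReal.ofReal ρ ≠ 0 := by simpa using hρ
  have hv0 : volume (Metric.ball z ρ) ≠ 0 := (Metric.measure_ball_pos _ _ hρ).ne'
  have hd0 : ‖z - ζ‖ₑ ≠ 0 := enorm_ne_zero.2 (sub_ne_zero.2 hne)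
  rw [← div_eq_mul_inv 4, ENNReal.le_div_iff_mul_le (Or.inl hd0) (Or.inl enorm_ne_top)]
  have hpt : ∀ x ∈ Metric.ball z ρ, ‖x - ζ‖ₑ⁻¹ * ‖z - ζ‖ₑ ≤
      1 + ‖x - ζ‖ₑ⁻¹ * ENNReal.ofReal ρ := by
    intro x hx
    have h1 : ‖z - ζ‖ₑ ≤ ‖x - ζ‖ₑ + ENNReal.ofReal ρ := by
      rw [show z - ζ = (x - ζ) + (z - x) by ring]
      refine (enorm_add_le _ _).trans (add_le_add le_rfl ?_)
      rw [← ofReal_norm, ← dist_eq_norm, dist_comm]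
      exact ENNReal.ofReal_le_ofReal (Metric.mem_ball.1 hx).le
    calc _ ≤ ‖x - ζ‖ₑ⁻¹ * (‖x - ζ‖ₑ + ENNReal.ofReal ρ) := by gcongr
      _ ≤ _ := by
        rw [mul_add]
        gcongr
        exact ENNReal.inv_mul_le_one _
  have hm : Measurable fun x : ℂ => ‖x - ζ‖ₑ⁻¹ := by fun_prop
  calc (volume (Metric.ball z ρ))⁻¹ * (∫⁻ x in Metric.ball z ρ, ‖x - ζ‖ₑ⁻¹) * ‖z - ζ‖ₑ
      = (volume (Metric.ball z ρ))⁻¹ * ∫⁻ x in Metric.ball z ρ, ‖x - ζ‖ₑ⁻¹ * ‖z - ζ‖ₑ := by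
        rw [mul_assoc, lintegral_mul_const _ hm]
    _ ≤ (volume (Metric.ball z ρ))⁻¹ * ∫⁻ x in Metric.ball z ρ,
          (1 + ‖x - ζ‖ₑ⁻¹ * ENNReal.ofReal ρ) := by
        refine mul_le_mul' le_rfl ?_
        exact setLIntegral_mono' measurableSet_ball hpt
    _ = 1 + ((volume (Metric.ball z ρ))⁻¹ * ∫⁻ x in Metric.ball z ρ, ‖x - ζ‖ₑ⁻¹) *
          ENNReal.ofReal ρ := by
        rw [lintegral_add_left measurable_const, setLIntegral_const, lintegral_mul_const _ hm,
          mul_add, one_mul, ENNReal.inv_mul_cancel hv0 measure_ball_lt_top.ne, mul_assoc]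
    _ ≤ 1 + (3 * (ENNReal.ofReal ρ)⁻¹) * ENNReal.ofReal ρ := by
        exact add_le_add le_rfl (mul_le_mul' (average_enorm_inv_le z ζ hρ) le_rfl)
    _ = 4 := by
        rw [mul_assoc, ENNReal.inv_mul_cancel hρ' ENNReal.ofReal_ne_top]; norm_num

theorem integrableOn_mul_inv_of_potential_lt_top {F : ℂ → ℂ} (hF : IntegrableOn F disk) {z : ℂ}
    (h : potential F z < ⊤) : IntegrableOn (fun ζ => F ζ * (z - ζ)⁻¹) disk := by
  refine ⟨hF.1.mul (Measurable.aestronglyMeasurable (by fun_prop)), ?_⟩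
  rw [hasFiniteIntegral_iff_enorm]
  refine lt_of_le_of_lt (lintegral_mono fun ζ => ?_) h
  rw [enorm_mul]
  gcongr
  exact enorm_inv_le_inv_enorm _

/-- The Cauchy transform has its value as Lebesgue value wherever it converges absolutely. -/
theorem tendsto_average_cauchyTransform {F : ℂ → ℂ} (hF : IntegrableOn F disk) {z : ℂ}
    (h : potential F z < ⊤) :
    Tendsto (fun ρ : ℝ => (volume (Metric.ball z ρ))⁻¹ *
      ∫⁻ x in Metric.ball z ρ, ‖cauchyTransform F x - cauchyTransform F z‖ₑ) (𝓝[>] 0) (𝓝 0) := by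
  set D : ℂ → ℂ → ℝ≥0∞ := fun ζ x => ‖(x - ζ)⁻¹ - (z - ζ)⁻¹‖ₑ with hD
  have hDm : Measurable (Function.uncurry D) := by
    simp only [hD, Function.uncurry_def]; fun_prop
  -- `A ρ ζ` is the mean oscillation of the kernel about `z`. It tends to 0 for `ζ ≠ z` by
  -- continuity, and Tonelli bounds the mean oscillation of the transform by `∬|F| A ρ`.
  set A : ℝ → ℂ → ℝ≥0∞ := fun ρ ζ => (volume (Metric.ball z ρ))⁻¹ *
    ∫⁻ x in Metric.ball z ρ, D ζ x with hA
  have hAm : ∀ ρ, Measurable (A ρ) := fun ρ => (Measurable.lintegral_prod_right' hDm).const_mul _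
  have hlim : Tendsto (fun ρ : ℝ => ∫⁻ ζ in disk, ‖F ζ‖ₑ * A ρ ζ) (𝓝[>] 0) (𝓝 0) := by
    -- The constant 5 is 4 for the mean of `|x-ζ|⁻¹` plus 1 for the fixed term `|z-ζ|⁻¹`.
    have h5 : ∫⁻ ζ in disk, ‖F ζ‖ₑ * (5 * ‖z - ζ‖ₑ⁻¹) ≠ ⊤ := by
      have : ∀ ζ, ‖F ζ‖ₑ * (5 * ‖z - ζ‖ₑ⁻¹) = 5 * (‖F ζ‖ₑ * ‖z - ζ‖ₑ⁻¹) := fun ζ => by ring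
      simp only [this]
      rw [lintegral_const_mul' _ _ (by simp)]
      exact (ENNReal.mul_lt_top (by simp) h).ne
    have := tendsto_lintegral_filter_of_dominated_convergence' (μ := volume.restrict disk)
      (l := 𝓝[>] (0 : ℝ)) (F := fun ρ ζ => ‖F ζ‖ₑ * A ρ ζ) (f := fun _ => 0)
      (fun ζ => ‖F ζ‖ₑ * (5 * ‖z - ζ‖ₑ⁻¹))
      (Eventually.of_forall fun ρ => hF.1.enorm.mul (hAm ρ).aemeasurable) ?_ h5 ?_
    · simpa using this
    · filter_upwards [self_mem_nhdsWithin] with ρ hρ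
      refine Eventually.of_forall fun ζ => ?_
      gcongr
      have hρ0 : (0 : ℝ) < ρ := hρ
      have hv0 : volume (Metric.ball z ρ) ≠ 0 := (Metric.measure_ball_pos _ _ hρ0).ne'
      have hpt : ∀ x, D ζ x ≤ ‖x - ζ‖ₑ⁻¹ + ‖z - ζ‖ₑ⁻¹ := fun x =>
        enorm_sub_le.trans
          (add_le_add (enorm_inv_le_inv_enorm _) (enorm_inv_le_inv_enorm _))
      calc A ρ ζ ≤ (volume (Metric.ball z ρ))⁻¹ *
            ∫⁻ x in Metric.ball z ρ, (‖x - ζ‖ₑ⁻¹ + ‖z - ζ‖ₑ⁻¹) := by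
            simp only [hA]
            refine mul_le_mul' le_rfl ?_
            exact lintegral_mono hpt
        _ = (volume (Metric.ball z ρ))⁻¹ * (∫⁻ x in Metric.ball z ρ, ‖x - ζ‖ₑ⁻¹) +
            ((volume (Metric.ball z ρ))⁻¹ * volume (Metric.ball z ρ)) * ‖z - ζ‖ₑ⁻¹ := by
            rw [lintegral_add_right _ measurable_const, setLIntegral_const]; ring
        _ ≤ 4 * ‖z - ζ‖ₑ⁻¹ + 1 * ‖z - ζ‖ₑ⁻¹ := by
            rw [ENNReal.inv_mul_cancel hv0 measure_ball_lt_top.ne]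
            exact add_le_add (average_enorm_inv_le_inv z ζ hρ0) le_rfl
        _ = _ := by ring
    · filter_upwards [ae_restrict_of_ae (Measure.ae_ne volume z)] with ζ hζ
      have hc : ContinuousAt (fun x : ℂ => (x - ζ)⁻¹) z :=
        (continuousAt_id.sub continuousAt_const).inv₀ (sub_ne_zero.2 hζ.symm)
      have := ENNReal.Tendsto.const_mul (a := ‖F ζ‖ₑ) (tendsto_average_of_continuousAt hc)
        (Or.inr enorm_ne_top)
      rwa [mul_zero] at this
  refine tendsto_of_tendsto_of_tendsto_of_le_of_le tendsto_const_nhds hlim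
    (fun _ => zero_le) fun ρ => ?_
  have hae : ∀ᵐ x ∂(volume.restrict (Metric.ball z ρ)),
      IntegrableOn (fun ζ => F ζ * (x - ζ)⁻¹) disk := by
    have h1 := (integrable_cauchy_kernel hF (‖z‖ + ρ)).prod_right_ae
    refine ae_restrict_of_ae_restrict_of_subset (Metric.ball_subset_ball' ?_) h1
    simp [add_comm]
  have hpi : ‖(1 / (Real.pi : ℂ))‖ₑ ≤ 1 := by
    rw [← ofReal_norm, norm_div, norm_one, Complex.norm_real,
      Real.norm_of_nonneg Real.pi_pos.le]
    refine ENNReal.ofReal_le_one.2 ?_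
    rw [div_le_one Real.pi_pos]
    linarith [Real.two_le_pi]
  have hbd : ∀ᵐ x ∂(volume.restrict (Metric.ball z ρ)),
      ‖cauchyTransform F x - cauchyTransform F z‖ₑ ≤ ∫⁻ ζ in disk, ‖F ζ‖ₑ * D ζ x := by
    filter_upwards [hae] with x hx
    rw [cauchyTransform, cauchyTransform, ← mul_sub,
      ← integral_sub hx (integrableOn_mul_inv_of_potential_lt_top hF h), enorm_mul]
    refine (mul_le_of_le_one_left' hpi).trans ((enorm_integral_le_lintegral_enorm _).trans ?_)
    simp only [← mul_sub, enorm_mul, hD]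
    exact le_rfl
  calc _ ≤ (volume (Metric.ball z ρ))⁻¹ *
        ∫⁻ x in Metric.ball z ρ, ∫⁻ ζ in disk, ‖F ζ‖ₑ * D ζ x := by
        refine mul_le_mul' le_rfl ?_
        exact lintegral_mono_ae hbd
    _ = (volume (Metric.ball z ρ))⁻¹ *
        ∫⁻ ζ in disk, ∫⁻ x in Metric.ball z ρ, ‖F ζ‖ₑ * D ζ x := by
        congr 1
        refine lintegral_lintegral_swap (hF.1.comp_snd.enorm.mul ?_)
        exact (hDm.comp measurable_swap).aemeasurable
    _ = (volume (Metric.ball z ρ))⁻¹ *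
        ∫⁻ ζ in disk, ‖F ζ‖ₑ * ∫⁻ x in Metric.ball z ρ, D ζ x := by
        congr 1
        refine lintegral_congr fun ζ => ?_
        exact lintegral_const_mul _ (by simp only [hD]; fun_prop)
    _ ≤ ∫⁻ ζ in disk, (volume (Metric.ball z ρ))⁻¹ *
        (‖F ζ‖ₑ * ∫⁻ x in Metric.ball z ρ, D ζ x) := lintegral_const_mul_le _ _
    _ = _ := by
        refine lintegral_congr fun ζ => ?_
        simp only [hA]; ring

/-- Disc averages see only the a.e. class, so the a.e. decomposition determines the Lebesgue value
at every single point where the potential is finite. -/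
theorem hasLebesgueValue_add_cauchyTransform {w g F : ℂ → ℂ} (hF : IntegrableOn F disk)
    (hg : DifferentiableOn ℂ g disk) (he : ∀ᵐ x, x ∈ disk → w x = g x + cauchyTransform F x)
    {z : ℂ} (hz : z ∈ disk) (h : potential F z < ⊤) :
    HasLebesgueValue w z (g z + cauchyTransform F z) := by
  have hdn : disk ∈ 𝓝 z := Metric.isOpen_ball.mem_nhds hz
  refine hasLebesgueValue_of_tendsto ?_
  have h1 := (tendsto_average_of_continuousAt (hg.continuousOn.continuousAt hdn)).add
    (tendsto_average_cauchyTransform hF h)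
  rw [add_zero] at h1
  refine tendsto_of_tendsto_of_tendsto_of_le_of_le' tendsto_const_nhds h1
    (Eventually.of_forall fun _ => zero_le) ?_
  obtain ⟨δ, hδ, hsub⟩ := Metric.mem_nhds_iff.1 hdn
  filter_upwards [Ioo_mem_nhdsGT hδ] with ρ hρ
  have hsub' : Metric.ball z ρ ⊆ disk := (Metric.ball_subset_ball hρ.2.le).trans hsub
  have hm : AEMeasurable (fun x => ‖cauchyTransform F x - cauchyTransform F z‖ₑ)
      (volume.restrict (Metric.ball z ρ)) :=
    (((integrableOn_cauchyTransform hF 1).mono_set hsub').1.sub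
      aestronglyMeasurable_const).enorm
  rw [← mul_add, ← lintegral_add_right' _ hm]
  refine mul_le_mul' le_rfl ?_
  refine lintegral_mono_ae ((ae_restrict_iff' measurableSet_ball).2 ?_)
  filter_upwards [he] with x hx hxb
  rw [hx (hsub' hxb), add_sub_add_comm]
  exact enorm_add_le _ _

/-! ### Fourier coefficients of test functions and a criterion for boundary values -/

/-- The integral of `φ` against the character `e^{inθ}`. -/
noncomputable def circleCoeff (φ : ℝ → ℂ) (n : ℤ) : ℂ :=
  ∫ θ in (0 : ℝ)..(2 * Real.pi), Complex.exp (n * θ * Complex.I) * φ θ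

theorem norm_character (n : ℤ) (θ : ℝ) : ‖Complex.exp (n * θ * Complex.I)‖ = 1 := by
  have := Complex.norm_exp_ofReal_mul_I (n * θ)
  push_cast at this
  exact this

theorem norm_circleCoeff_le {φ : ℝ → ℂ} {M : ℝ} (h : ∀ θ, ‖φ θ‖ ≤ M) (n : ℤ) :
    ‖circleCoeff φ n‖ ≤ 2 * Real.pi * M := by
  have := intervalIntegral.norm_integral_le_of_norm_le_const (a := 0) (b := 2 * Real.pi)
    (f := fun θ : ℝ => Complex.exp (n * θ * Complex.I) * φ θ) (C := M) fun θ _ => by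
      rw [norm_mul, norm_character, one_mul]; exact h θ
  rw [sub_zero, abs_of_pos Real.two_pi_pos] at this
  exact this.trans_eq (mul_comm _ _)

theorem circleCoeff_deriv {φ : ℝ → ℂ} (hφ : ContDiff ℝ ∞ φ)
    (hp : Function.Periodic φ (2 * Real.pi)) (n : ℤ) :
    circleCoeff (deriv φ) n = -(n * Complex.I) * circleCoeff φ n := by
  have hE : ∀ θ : ℝ, HasDerivAt (fun θ : ℝ => Complex.exp (n * θ * Complex.I))
      (n * Complex.I * Complex.exp (n * θ * Complex.I)) θ := by
    intro θ
    have := ((((Complex.ofRealCLM.hasDerivAt (x := θ)).const_mul (n : ℂ)).mul_const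
      Complex.I)).cexp
    refine this.congr_deriv ?_
    simp [mul_comm]
  have hd : ∀ θ, HasDerivAt φ (deriv φ θ) θ := fun θ =>
    (hφ.differentiable (by simp) θ).hasDerivAt
  have hdc : Continuous (deriv φ) := hφ.continuous_deriv (by simp)
  have := intervalIntegral.integral_mul_deriv_eq_deriv_mul (a := 0) (b := 2 * Real.pi)
    (fun θ _ => hE θ) (fun θ _ => hd θ)
    (Continuous.intervalIntegrable (by fun_prop) _ _) (hdc.intervalIntegrable _ _)
  have h2 : φ (2 * Real.pi) = φ 0 := by simpa using hp 0
  have h3 : Complex.exp (n * (2 * Real.pi : ℝ) * Complex.I) = 1 := by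
    rw [Complex.exp_eq_one_iff]
    exact ⟨n, by push_cast; ring⟩
  rw [h2, h3] at this
  simp only [circleCoeff]
  rw [this, ← intervalIntegral.integral_const_mul]
  simp only [Complex.ofReal_zero, mul_zero, zero_mul, Complex.exp_zero, sub_self, zero_sub,
    neg_mul, intervalIntegral.integral_neg, mul_assoc]

theorem norm_circleCoeff_mul_pow_le {φ : ℝ → ℂ} (hφ : ContDiff ℝ ∞ φ)
    (hp : Function.Periodic φ (2 * Real.pi)) (n : ℤ) (k : ℕ) {M : ℝ}
    (hM : ∀ θ, ‖iteratedDeriv k φ θ‖ ≤ M) :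
    ‖circleCoeff φ n‖ * |(n : ℝ)| ^ k ≤ 2 * Real.pi * M := by
  induction k generalizing φ with
  | zero =>
    rw [pow_zero, mul_one]
    exact norm_circleCoeff_le (by simpa using hM) n
  | succ k ih =>
    have hp' : Function.Periodic (deriv φ) (2 * Real.pi) := by
      intro θ
      rw [← deriv_comp_add_const]
      congr 1
      exact funext hp
    have := ih (φ := deriv φ) (contDiff_infty_iff_deriv.1 hφ).2 hp' (fun θ => by
      rw [← iteratedDeriv_succ']; exact hM θ)
    rw [circleCoeff_deriv hφ hp, norm_mul, norm_neg, norm_mul, Complex.norm_I, mul_one,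
      Complex.norm_intCast] at this
    rw [pow_succ]
    linarith

theorem norm_circleCoeff_nat_le {φ : ℝ → ℂ} (hφ : ContDiff ℝ ∞ φ)
    (hp : Function.Periodic φ (2 * Real.pi)) {m : ℤ} {n : ℕ} (hmn : |m| = n) (k : ℕ) {M : ℝ}
    (hM : ∀ j ≤ k, ∀ θ, ‖iteratedDeriv j φ θ‖ ≤ M) :
    ‖circleCoeff φ m‖ * ((n : ℝ) + 1) ^ k ≤ 2 ^ k * (2 * Real.pi * M) := by
  have hmn' : |(m : ℝ)| = n := by exact_mod_cast congrArg (Int.cast (R := ℝ)) hmn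
  rcases Nat.eq_zero_or_pos n with rfl | hn
  · have h0 := norm_circleCoeff_mul_pow_le hφ hp m 0 (hM 0 (Nat.zero_le _))
    have h1 : (1 : ℝ) ≤ 2 ^ k := one_le_pow₀ (by norm_num)
    have h2 : 0 ≤ 2 * Real.pi * M := le_trans (by positivity) h0
    simp only [pow_zero, mul_one, Nat.cast_zero, zero_add, one_pow] at h0 ⊢
    nlinarith
  · have h0 := norm_circleCoeff_mul_pow_le hφ hp m k (hM k le_rfl)
    rw [hmn'] at h0
    have hn1 : (1 : ℝ) ≤ n := by exact_mod_cast hn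
    calc ‖circleCoeff φ m‖ * ((n : ℝ) + 1) ^ k ≤ ‖circleCoeff φ m‖ * (2 * n) ^ k := by
          gcongr; linarith
      _ = 2 ^ k * (‖circleCoeff φ m‖ * (n : ℝ) ^ k) := by rw [mul_pow]; ring
      _ ≤ _ := by gcongr

/-- Two derivatives beyond the `N` needed for the weight buy the summable factor `1/(n+1)²`. -/
theorem norm_circleCoeff_mul_pow_le_div {φ : ℝ → ℂ} (hφ : ContDiff ℝ ∞ φ)
    (hp : Function.Periodic φ (2 * Real.pi)) {m : ℤ} {n : ℕ} (hmn : |m| = n) (N : ℕ) {M : ℝ}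
    (hM : ∀ j ≤ N + 2, ∀ θ, ‖iteratedDeriv j φ θ‖ ≤ M) :
    ‖circleCoeff φ m‖ * ((n : ℝ) + 1) ^ N ≤
      2 ^ (N + 2) * (2 * Real.pi * M) * (1 / ((n : ℝ) + 1) ^ 2) := by
  have h := norm_circleCoeff_nat_le hφ hp hmn (N + 2) hM
  rw [mul_one_div, le_div_iff₀ (by positivity)]
  rw [pow_add ((n : ℝ) + 1)] at h
  linarith

theorem summable_one_div_add_one_sq : Summable fun n : ℕ => 1 / ((n : ℝ) + 1) ^ 2 := by
  have := (summable_nat_add_iff 1).2 (Real.summable_one_div_nat_pow.2 (le_refl 2))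
  simpa using this

/-- Smooth periodic functions have bounded derivatives. -/
theorem CircleTest.exists_bound (φ : CircleTest) (k : ℕ) :
    ∃ M : ℝ, ∀ j ≤ k, ∀ θ : ℝ, ‖iteratedDeriv j (φ : ℝ → ℂ) θ‖ ≤ M := by
  have h1 : ∀ j : ℕ, ∃ M : ℝ, ∀ θ : ℝ, ‖iteratedDeriv j (φ : ℝ → ℂ) θ‖ ≤ M := by
    intro j
    have hc : Continuous (iteratedDeriv j (φ : ℝ → ℂ)) :=
      φ.2.1.continuous_iteratedDeriv j (by exact_mod_cast le_top)
    have hper : Function.Periodic (iteratedDeriv j (φ : ℝ → ℂ)) (2 * Real.pi) := by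
      intro θ
      have := congrFun (iteratedDeriv_comp_add_const j (φ : ℝ → ℂ) (2 * Real.pi)) θ
      rw [← this]
      congr 1
      exact funext φ.2.2
    obtain ⟨M, hM⟩ := (isCompact_Icc (a := (0 : ℝ)) (b := 2 * Real.pi)).exists_bound_of_continuousOn
      hc.continuousOn
    refine ⟨M, fun θ => ?_⟩
    obtain ⟨y, hy, he⟩ := hper.exists_mem_Ico₀ Real.two_pi_pos θ
    rw [he]
    exact hM y ⟨hy.1, hy.2.le⟩
  choose M hM using h1
  refine ⟨∑ j ∈ Finset.range (k + 1), |M j|, fun j hj θ => ?_⟩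
  refine (hM j θ).trans ((le_abs_self _).trans ?_)
  exact Finset.single_le_sum (f := fun j => |M j|) (fun _ _ => abs_nonneg _)
    (Finset.mem_range.2 (Nat.lt_succ_of_le hj))

theorem CircleTest.summable_norm_circleCoeff (φ : CircleTest) {σ : ℤ} (hσ : |σ| = 1) :
    Summable fun n : ℕ => ‖circleCoeff φ (σ * n)‖ := by
  obtain ⟨M, hM⟩ := CircleTest.exists_bound φ 2
  refine Summable.of_nonneg_of_le (fun _ => norm_nonneg _) (fun n => ?_)
    (summable_one_div_add_one_sq.mul_left (2 ^ (0 + 2) * (2 * Real.pi * M)))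
  have := norm_circleCoeff_mul_pow_le_div φ.2.1 φ.2.2 (m := σ * n) (n := n)
    (by rw [abs_mul, hσ]; simp) 0 hM
  simpa using this

theorem hasSum_integral_character_series {φ : ℝ → ℂ} (hφ : Continuous φ) {b : ℕ → ℂ}
    (hb : Summable fun n => ‖b n‖) {g : ℝ → ℂ} (σ : ℤ)
    (hg : ∀ θ : ℝ, HasSum (fun n : ℕ => b n * Complex.exp ((σ * n : ℤ) * θ * Complex.I)) (g θ)) :
    HasSum (fun n : ℕ => b n * circleCoeff φ (σ * n))
      (∫ θ in (0 : ℝ)..(2 * Real.pi), g θ * φ θ) := by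
  obtain ⟨M, hM⟩ := (isCompact_Icc (a := (0 : ℝ)) (b := 2 * Real.pi)).exists_bound_of_continuousOn
      hφ.continuousOn
  have := intervalIntegral.hasSum_integral_of_dominated_convergence (μ := volume) (a := 0)
    (b := 2 * Real.pi)
    (F := fun (n : ℕ) (θ : ℝ) => b n * Complex.exp ((σ * n : ℤ) * θ * Complex.I) * φ θ)
    (f := fun θ => g θ * φ θ) (fun n _ => ‖b n‖ * M)
    (fun n => (Continuous.aestronglyMeasurable (by fun_prop)))
    (fun n => Eventually.of_forall fun θ hθ => ?_)
    (Eventually.of_forall fun θ _ => hb.mul_right M)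
    intervalIntegrable_const
    (Eventually.of_forall fun θ _ => (hg θ).mul_right _)
  · simp only [mul_assoc, intervalIntegral.integral_const_mul] at this
    simpa only [circleCoeff, mul_assoc] using this
  · rw [norm_mul, norm_mul, norm_character, mul_one]
    rw [uIoc_of_le Real.two_pi_pos.le] at hθ
    gcongr
    exact hM θ ⟨hθ.1.le, hθ.2⟩

/-- Expanding the geometric series turns the pairing into a power series in `x` whose coefficients
are Fourier coefficients of `φ`. The bound is independent of `x`, although the kernel itself blows
up as `|x| → 1`. -/
theorem norm_integral_div_one_sub_le (φ : CircleTest) {σ : ℤ} (hσ : |σ| = 1) {x : ℂ}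
    (hx : ‖x‖ < 1) :
    ‖∫ θ in (0 : ℝ)..(2 * Real.pi),
      (1 - x * Complex.exp (σ * θ * Complex.I))⁻¹ * (φ : ℝ → ℂ) θ‖ ≤
      ∑' n : ℕ, ‖circleCoeff φ (σ * n)‖ := by
  have hb : Summable fun n : ℕ => ‖x ^ n‖ := by
    simp only [norm_pow]
    exact summable_geometric_of_lt_one (norm_nonneg _) hx
  have h := hasSum_integral_character_series (φ := (φ : ℝ → ℂ)) φ.2.1.continuous hb
    (g := fun θ => (1 - x * Complex.exp (σ * θ * Complex.I))⁻¹) σ fun θ => by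
      have h1 : ‖x * Complex.exp (σ * θ * Complex.I)‖ < 1 := by
        rwa [norm_mul, norm_character, mul_one]
      have h2 := hasSum_geometric_of_norm_lt_one h1
      have e : ∀ n : ℕ, (x * Complex.exp (σ * θ * Complex.I)) ^ n =
          x ^ n * Complex.exp ((σ * n : ℤ) * θ * Complex.I) := fun n => by
        rw [mul_pow, ← Complex.exp_nat_mul]
        push_cast; ring_nf
      simpa only [e] using h2
  have hs := CircleTest.summable_norm_circleCoeff φ hσ
  have hle : ∀ n : ℕ, ‖x ^ n * circleCoeff φ (σ * n)‖ ≤ ‖circleCoeff φ (σ * n)‖ := fun n => by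
    rw [norm_mul, norm_pow]
    exact mul_le_of_le_one_left (norm_nonneg _) (pow_le_one₀ (norm_nonneg _) hx.le)
  rw [← h.tsum_eq]
  exact tsum_of_norm_bounded hs.hasSum hle

/-- Pointwise limits of the circle pairings are linear in `φ`, and a bound valid for `r` near 1
passes to the limit and gives continuity. -/
theorem exists_hasBoundaryValue {g : ℂ → ℂ} (k : ℕ) (C : ℝ)
    (hi : ∀ φ : CircleTest, ∀ r ∈ Ioo (0 : ℝ) 1, IntervalIntegrable
      (fun θ : ℝ => g (circleMap 0 r θ) * (φ : ℝ → ℂ) θ) volume 0 (2 * Real.pi))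
    (hlim : ∀ φ : CircleTest, ∃ L : ℂ, Tendsto (fun r : ℝ => ∫ θ in (0 : ℝ)..(2 * Real.pi),
      g (circleMap 0 r θ) * (φ : ℝ → ℂ) θ) (𝓝[<] 1) (𝓝 L))
    (hbd : ∀ (φ : CircleTest) (M : ℝ), (∀ j ≤ k, ∀ θ : ℝ, ‖iteratedDeriv j (φ : ℝ → ℂ) θ‖ ≤ M) →
      ∀ᶠ r in 𝓝[<] (1 : ℝ), ‖∫ θ in (0 : ℝ)..(2 * Real.pi),
        g (circleMap 0 r θ) * (φ : ℝ → ℂ) θ‖ ≤ C * M) :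
    ∃ u : CircleDistribution, HasBoundaryValue g u := by
  choose L hL using hlim
  have hIoo : Ioo (0 : ℝ) 1 ∈ 𝓝[<] (1 : ℝ) := Ioo_mem_nhdsLT one_pos
  let T : CircleTest →ₗ[ℂ] ℂ :=
    { toFun := L
      map_add' := fun φ ψ => by
        refine tendsto_nhds_unique (hL (φ + ψ)) (((hL φ).add (hL ψ)).congr' ?_)
        filter_upwards [hIoo] with r hr
        rw [← intervalIntegral.integral_add (hi φ r hr) (hi ψ r hr)]
        congr 1; ext θ
        change _ = g _ * ((φ : ℝ → ℂ) θ + (ψ : ℝ → ℂ) θ)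
        ring
      map_smul' := fun c φ => by
        refine tendsto_nhds_unique (hL (c • φ)) (((hL φ).const_mul c).congr' ?_)
        filter_upwards [hIoo] with r hr
        rw [← intervalIntegral.integral_const_mul]
        congr 1; ext θ
        change _ = g _ * (c * (φ : ℝ → ℂ) θ)
        ring }
  exact ⟨⟨T, k, C, fun φ M hM => le_of_tendsto (hL φ).norm (hbd φ M hM)⟩,
    fun φ => ⟨hi φ, hL φ⟩⟩

/-! ### Growth of functions in the Hardy space -/

theorem hardyNorm_lt_top_iff {p : ℝ} (hp : 0 < p) (w : ℂ → ℂ) :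
    hardyNorm p w < ⊤ ↔ ∃ K : ℝ≥0∞, K ≠ ⊤ ∧ ∀ r ∈ Ioo (0 : ℝ) 1,
      ∫⁻ θ in Ioc (0 : ℝ) (2 * Real.pi), ‖w (circleMap 0 r θ)‖ₑ ^ p ≤ K := by
  have hc0 : ENNReal.ofReal (2 * Real.pi) ≠ 0 := by simpa using Real.pi_pos
  have hct : ENNReal.ofReal (2 * Real.pi) ≠ ⊤ := ENNReal.ofReal_ne_top
  rw [hardyNorm, ENNReal.rpow_lt_top_iff_of_pos (by positivity)]
  constructor
  · intro h
    refine ⟨ENNReal.ofReal (2 * Real.pi) * _, ENNReal.mul_ne_top hct h.ne, fun r hr => ?_⟩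
    rw [← ENNReal.inv_mul_le_iff hc0 hct]
    exact le_iSup₂ (f := fun r (_ : r ∈ Ioo (0 : ℝ) 1) => (ENNReal.ofReal (2 * Real.pi))⁻¹ *
      ∫⁻ θ in Ioc (0 : ℝ) (2 * Real.pi), ‖w (circleMap 0 r θ)‖ₑ ^ p) r hr
  · rintro ⟨K, hK, h⟩
    refine lt_of_le_of_lt (iSup₂_le fun r hr => mul_le_mul' le_rfl (h r hr))
      (ENNReal.mul_lt_top (by simpa using Real.pi_pos) hK.lt_top)

theorem circleMap_mem_disk {r : ℝ} (hr : r ∈ Ioo (0 : ℝ) 1) (θ : ℝ) : circleMap 0 r θ ∈ disk := by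
  rw [mem_disk, norm_circleMap_zero, abs_of_pos hr.1]; exact hr.2

/-- Cauchy's estimate by the mean over a circle. -/
theorem norm_le_integral_circle {h : ℂ → ℂ} {R : ℝ} (hR : 0 < R)
    (hh : DiffContOnCl ℂ h (Metric.ball 0 R)) {z : ℂ} (hz : ‖z‖ < R) :
    ‖h z‖ ≤ R / (R - ‖z‖) * ∫ θ in (0 : ℝ)..(2 * Real.pi), ‖h (circleMap 0 R θ)‖ := by
  have hcont : Continuous fun θ : ℝ => h (circleMap 0 R θ) := by
    refine hh.continuousOn.comp_continuous (continuous_circleMap 0 R) fun θ => ?_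
    rw [closure_ball _ hR.ne']
    exact circleMap_mem_closedBall 0 hR.le θ
  have hd : 0 < R - ‖z‖ := sub_pos.2 hz
  have h1 := hh.two_pi_i_inv_smul_circleIntegral_sub_inv_smul (w := z) (by simpa using hz)
  rw [← h1, norm_smul]
  have h2 : ‖(2 * Real.pi * Complex.I : ℂ)⁻¹‖ ≤ 1 := by
    rw [norm_inv]
    refine inv_le_one_of_one_le₀ ?_
    simp only [norm_mul, Complex.norm_I, mul_one, Complex.norm_real, Complex.norm_ofNat,
      Real.norm_of_nonneg Real.pi_pos.le]
    linarith [Real.two_le_pi]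
  have h3 : ‖∮ ζ in C(0, R), (ζ - z)⁻¹ • h ζ‖ ≤
      ∫ θ in (0 : ℝ)..(2 * Real.pi), R / (R - ‖z‖) * ‖h (circleMap 0 R θ)‖ := by
    rw [circleIntegral]
    refine intervalIntegral.norm_integral_le_of_norm_le Real.two_pi_pos.le
      (Eventually.of_forall fun θ _ => ?_)
      ((continuous_const.mul hcont.norm).intervalIntegrable _ _)
    rw [deriv_circleMap, norm_smul, norm_smul, norm_mul, Complex.norm_I, mul_one,
      norm_circleMap_zero, abs_of_pos hR, norm_inv, ← mul_assoc, div_eq_mul_inv]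
    gcongr
    have := norm_sub_norm_le (circleMap 0 R θ) z
    rwa [norm_circleMap_zero, abs_of_pos hR] at this
  rw [intervalIntegral.integral_const_mul] at h3
  calc _ ≤ 1 * ‖∮ ζ in C(0, R), (ζ - z)⁻¹ • h ζ‖ := by gcongr
    _ ≤ _ := by rw [one_mul]; exact h3

/-- A self-improving estimate in place of subharmonicity of `|Φ|^p`. Let `N` be the maximum of
`(1-|z|)^{1/p}|h(z)|`. Cauchy's estimate at a maximum point involves the mean of `|h| =
|h|^{1-p}|h|^p`; bounding the first factor through `N` gives `N ≤ N^{1-p} · 2^{1/p} K`, and dividing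
bounds `N^p`. -/
theorem weighted_bound_of_hardy {p : ℝ} (hp0 : 0 < p) (hp1 : p ≤ 1) {Φ : ℂ → ℂ}
    (hΦ : DifferentiableOn ℂ Φ disk) {K : ℝ≥0∞} (hK : K ≠ ⊤)
    (hb : ∀ r ∈ Ioo (0 : ℝ) 1,
      ∫⁻ θ in Ioc (0 : ℝ) (2 * Real.pi), ‖Φ (circleMap 0 r θ)‖ₑ ^ p ≤ K)
    {s : ℝ} (hs : s ∈ Ioo (0 : ℝ) 1) {z : ℂ} (hz : ‖z‖ ≤ 1) :
    (1 - ‖z‖) ^ (1 / p) * ‖Φ (s * z)‖ ≤ (2 ^ (1 / p) * K.toReal) ^ (1 / p) := by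
  set α := 1 / p with hα
  have hα0 : 0 < α := by positivity
  -- Dilating by `s < 1` makes `h` continuous on the closed disk, so the maximum is attained and
  -- finite; the final bound does not depend on `s`.
  set h : ℂ → ℂ := fun z => Φ (s * z) with hh
  have hmaps : ∀ z : ℂ, ‖z‖ ≤ 1 → (s : ℂ) * z ∈ disk := fun z hz => by
    rw [mem_disk, norm_mul, Complex.norm_real, Real.norm_of_nonneg hs.1.le]
    nlinarith [hs.1, hs.2, norm_nonneg z]
  have hdiff : ∀ z : ℂ, ‖z‖ ≤ 1 → DifferentiableAt ℂ h z := fun z hz =>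
    DifferentiableAt.comp z (hΦ.differentiableAt (Metric.isOpen_ball.mem_nhds (hmaps z hz)))
      (differentiableAt_id.const_mul _)
  have hGc : ContinuousOn (fun z : ℂ => (1 - ‖z‖) ^ α * ‖h z‖) (Metric.closedBall 0 1) := by
    refine ContinuousOn.mul ?_ ?_
    · exact (Continuous.rpow_const (by fun_prop) fun _ => Or.inr hα0.le).continuousOn
    · exact fun z hz => (hdiff z (by simpa using hz)).continuousAt.norm.continuousWithinAt
  obtain ⟨z0, hz0, hmax⟩ := (isCompact_closedBall (0 : ℂ) 1).exists_isMaxOn ⟨0, by simp⟩ hGc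
  have hz0' : ‖z0‖ ≤ 1 := by simpa using hz0
  set N := (1 - ‖z0‖) ^ α * ‖h z0‖ with hN
  have hle : ∀ z : ℂ, ‖z‖ ≤ 1 → (1 - ‖z‖) ^ α * ‖h z‖ ≤ N := fun z hz =>
    hmax (by simpa using hz)
  refine (hle z hz).trans ?_
  have hN0 : 0 ≤ N := mul_nonneg (Real.rpow_nonneg (by linarith) _) (norm_nonneg _)
  rcases hN0.eq_or_lt with hN0 | hN0
  · rw [← hN0]; positivity
  have hlt : ‖z0‖ < 1 := by
    refine lt_of_le_of_ne hz0' fun he => hN0.ne' ?_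
    rw [hN, he, sub_self, Real.zero_rpow hα0.ne', zero_mul]
  -- The circle of radius `R = 1 - d` lies halfway between `z0` and the boundary, at distance `d`
  -- from both.
  set d := (1 - ‖z0‖) / 2 with hd
  have hd0 : 0 < d := by linarith
  set R := 1 - d with hR
  have hR0 : 0 < R := by have := norm_nonneg z0; linarith
  have hR1 : R < 1 := by linarith
  set X := d ^ α with hX
  have hX0 : 0 < X := Real.rpow_pos_of_pos hd0 _
  have hXp : X ^ p = d := by
    rw [hX, ← Real.rpow_mul hd0.le, hα, one_div_mul_cancel hp0.ne', Real.rpow_one]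
  have hcirc : ∀ θ, ‖circleMap 0 R θ‖ = R := fun θ => by
    rw [norm_circleMap_zero, abs_of_pos hR0]
  have hcont : Continuous fun θ : ℝ => h (circleMap 0 R θ) := by
    refine continuous_iff_continuousAt.2 fun θ => ?_
    exact ContinuousAt.comp (f := circleMap 0 R) (g := h)
      (hdiff _ (by rw [hcirc]; exact hR1.le)).continuousAt (continuous_circleMap 0 R).continuousAt
  have hpt : ∀ θ, ‖h (circleMap 0 R θ)‖ ≤ (N / X) ^ (1 - p) * ‖h (circleMap 0 R θ)‖ ^ p := by
    intro θ
    have h1 := hle (circleMap 0 R θ) (by rw [hcirc]; exact hR1.le)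
    rw [hcirc, show 1 - R = d by rw [hR]; ring, ← hX] at h1
    have h2 : ‖h (circleMap 0 R θ)‖ ≤ N / X := by rwa [le_div_iff₀' hX0]
    rcases (norm_nonneg (h (circleMap 0 R θ))).eq_or_lt with h0 | h0
    · rw [← h0]; positivity
    · calc ‖h (circleMap 0 R θ)‖
          = ‖h (circleMap 0 R θ)‖ ^ (1 - p) * ‖h (circleMap 0 R θ)‖ ^ p := by
            rw [← Real.rpow_add h0, sub_add_cancel, Real.rpow_one]
        _ ≤ _ := by
            gcongr
  have hint : ∫ θ in (0 : ℝ)..(2 * Real.pi), ‖h (circleMap 0 R θ)‖ ^ p ≤ K.toReal := by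
    have hcp : Continuous fun θ : ℝ => ‖h (circleMap 0 R θ)‖ ^ p :=
      hcont.norm.rpow_const fun _ => Or.inr hp0.le
    rw [intervalIntegral.integral_of_le Real.two_pi_pos.le,
      integral_eq_lintegral_of_nonneg_ae (Eventually.of_forall fun θ => by positivity)
        hcp.aestronglyMeasurable]
    refine ENNReal.toReal_mono hK (le_trans (le_of_eq ?_)
      (hb (s * R) ⟨by have := hs.1; positivity, by nlinarith [hs.1, hs.2]⟩))
    refine lintegral_congr fun θ => ?_
    rw [← ENNReal.ofReal_rpow_of_nonneg (norm_nonneg _) hp0.le, ofReal_norm]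
    simp only [hh, circleMap]
    congr 4; push_cast; ring
  have hmain : ‖h z0‖ ≤ 1 / d * ((N / X) ^ (1 - p) * K.toReal) := by
    have h1 := norm_le_integral_circle hR0 (h := h) (z := z0) ?_ (by linarith)
    · refine h1.trans ?_
      rw [show R - ‖z0‖ = d by rw [hR, hd]; ring]
      have hI0 : 0 ≤ ∫ θ in (0 : ℝ)..(2 * Real.pi), ‖h (circleMap 0 R θ)‖ :=
        intervalIntegral.integral_nonneg Real.two_pi_pos.le fun _ _ => norm_nonneg _
      have h2 : ∫ θ in (0 : ℝ)..(2 * Real.pi), ‖h (circleMap 0 R θ)‖ ≤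
          (N / X) ^ (1 - p) * K.toReal := by
        calc _ ≤ ∫ θ in (0 : ℝ)..(2 * Real.pi),
              (N / X) ^ (1 - p) * ‖h (circleMap 0 R θ)‖ ^ p := by
              refine intervalIntegral.integral_mono_on Real.two_pi_pos.le
                (hcont.norm.intervalIntegrable _ _) (Continuous.intervalIntegrable ?_ _ _)
                fun θ _ => hpt θ
              exact (hcont.norm.rpow_const fun _ => Or.inr hp0.le).const_mul _
          _ ≤ _ := by
              rw [intervalIntegral.integral_const_mul]
              gcongr
      gcongr
    · refine DifferentiableOn.diffContOnCl fun z hz => ?_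
      rw [closure_ball _ hR0.ne', mem_closedBall_zero_iff] at hz
      exact (hdiff z (hz.trans hR1.le)).differentiableWithinAt
  have hNp : N ≤ N ^ (1 - p) * (2 ^ α * K.toReal) := by
    have e1 : N = 2 ^ α * X * ‖h z0‖ := by
      rw [hN, hX, ← Real.mul_rpow (by norm_num) hd0.le, hd, mul_div_cancel₀ _ two_ne_zero]
    calc N = 2 ^ α * X * ‖h z0‖ := e1
      _ ≤ 2 ^ α * X * (1 / d * ((N / X) ^ (1 - p) * K.toReal)) := by gcongr
      _ = N ^ (1 - p) * (2 ^ α * K.toReal) * (X / (d * X ^ (1 - p))) := by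
          rw [Real.div_rpow hN0.le hX0.le]
          have : X ^ (1 - p) ≠ 0 := (Real.rpow_pos_of_pos hX0 _).ne'
          field_simp
      _ = _ := by
          -- The weight exponent `1/p` is chosen so that `X^p = d`, which cancels the factor `1/d`
          -- of Cauchy's estimate.
          have : d * X ^ (1 - p) = X := by
            rw [← hXp, ← Real.rpow_add hX0, add_sub_cancel, Real.rpow_one]
          rw [this, div_self hX0.ne', mul_one]
  have hNp' : N ^ p ≤ 2 ^ α * K.toReal := by
    have h1 : 0 < N ^ (1 - p) := Real.rpow_pos_of_pos hN0 _
    refine le_of_mul_le_mul_left ?_ h1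
    rwa [← Real.rpow_add hN0, sub_add_cancel, Real.rpow_one]
  calc N = (N ^ p) ^ α := by
        rw [← Real.rpow_mul hN0.le, hα, mul_one_div_cancel hp0.ne', Real.rpow_one]
    _ ≤ _ := by gcongr

/-- Functions of the Hardy space grow at most polynomially. -/
theorem exists_growth_of_hardy {p : ℝ} (hp0 : 0 < p) (hp1 : p ≤ 1) {Φ : ℂ → ℂ}
    (hΦ : Φ ∈ HolHardy p) :
    ∃ (N : ℕ) (A : ℝ), ∀ z ∈ disk, ‖Φ z‖ * (1 - ‖z‖) ^ N ≤ A := by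
  obtain ⟨K, hK, hb⟩ := (hardyNorm_lt_top_iff hp0 Φ).1 hΦ.2
  set C := (2 ^ (1 / p) * K.toReal) ^ (1 / p)
  obtain ⟨N, hN⟩ := exists_nat_ge (1 / p)
  refine ⟨N, 2 ^ N * C, fun z hz => ?_⟩
  have hz1 := mem_disk.1 hz
  have hz0 := norm_nonneg z
  -- With this dilation `z/s` stays in the disk and `1 - |z|/s ≥ (1-|z|)/2`.
  set s := (1 + ‖z‖) / 2 with hs
  have hs0 : 0 < s := by linarith
  have hs1 : s < 1 := by linarith
  have hn : ‖z / s‖ = ‖z‖ / s := by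
    rw [norm_div, Complex.norm_real, Real.norm_of_nonneg hs0.le]
  have hle : ‖z‖ / s ≤ 1 := by rw [div_le_one hs0]; linarith
  have h1 := weighted_bound_of_hardy hp0 hp1 hΦ.1 hK hb ⟨hs0, hs1⟩ (z := z / s) (by rwa [hn])
  rw [mul_div_cancel₀ _ (by exact_mod_cast hs0.ne'), hn] at h1
  have h2 : (1 - ‖z‖) / 2 ≤ 1 - ‖z‖ / s := by
    have : 1 - ‖z‖ / s = (s - ‖z‖) / s := by field_simp
    rw [this, le_div_iff₀ hs0]
    nlinarith
  have h3 : ((1 - ‖z‖) / 2) ^ N ≤ (1 - ‖z‖ / s) ^ (1 / p) := by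
    have h0 : 0 < (1 - ‖z‖) / 2 := by linarith
    calc ((1 - ‖z‖) / 2) ^ N = ((1 - ‖z‖) / 2) ^ (N : ℝ) := (Real.rpow_natCast _ _).symm
      _ ≤ ((1 - ‖z‖) / 2) ^ (1 / p) :=
        Real.rpow_le_rpow_of_exponent_ge h0 (by linarith) hN
      _ ≤ _ := Real.rpow_le_rpow h0.le h2 (by positivity)
  have h4 : ((1 - ‖z‖) / 2) ^ N * ‖Φ z‖ ≤ C :=
    (mul_le_mul_of_nonneg_right h3 (norm_nonneg _)).trans h1
  rw [div_pow, div_mul_eq_mul_div, div_le_iff₀ (by positivity)] at h4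
  linarith

/-! ### Boundary values of holomorphic functions of polynomial growth -/

/-- Cauchy's estimate on the radius `r = (n+1)/(n+2)`: there `1 - r = 1/(n+2)`, so the growth costs
`(n+2)^N ≤ (2(n+1))^N`, while `r^{-n} = (1 + 1/(n+1))^n ≤ e ≤ 3`. -/
theorem norm_taylorCoeff_le {Φ : ℂ → ℂ} (hΦ : DifferentiableOn ℂ Φ disk) {N : ℕ} {A : ℝ}
    (hA : ∀ z ∈ disk, ‖Φ z‖ * (1 - ‖z‖) ^ N ≤ A) (n : ℕ) :
    ‖((n.factorial : ℂ))⁻¹ * iteratedDeriv n Φ 0‖ ≤ 3 * 2 ^ N * A * ((n : ℝ) + 1) ^ N := by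
  set r : ℝ := ((n : ℝ) + 1) / ((n : ℝ) + 2) with hr
  have hn0 : (0 : ℝ) ≤ n := n.cast_nonneg
  have hr0 : 0 < r := by positivity
  have hr1 : r < 1 := by rw [hr, div_lt_one (by positivity)]; linarith
  have h1r : 1 - r = 1 / ((n : ℝ) + 2) := by rw [hr]; field_simp; ring
  have hA0 : 0 ≤ A := le_trans (by simp) (hA 0 (by simp [disk]))
  have hsub : Metric.closedBall (0 : ℂ) r ⊆ disk := Metric.closedBall_subset_ball hr1
  have hsph : ∀ z ∈ Metric.sphere (0 : ℂ) r, ‖Φ z‖ ≤ A * ((n : ℝ) + 2) ^ N := by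
    intro z hz
    have h1 := hA z (hsub (Metric.sphere_subset_closedBall hz))
    rw [mem_sphere_zero_iff_norm.1 hz, h1r, one_div, inv_pow, ← div_eq_mul_inv,
      div_le_iff₀ (by positivity)] at h1
    exact h1
  have hdc : DiffContOnCl ℂ Φ (Metric.ball 0 r) := by
    refine DifferentiableOn.diffContOnCl (hΦ.mono ?_)
    rwa [closure_ball _ hr0.ne']
  have hC := Complex.norm_iteratedDeriv_le_of_forall_mem_sphere_norm_le n hr0 hdc hsph
  have hrn : (r ^ n)⁻¹ ≤ 3 := by
    have h1 : r⁻¹ = 1 / ((n : ℝ) + 1) + 1 := by rw [hr]; field_simp; ring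
    rw [← inv_pow, h1]
    calc (1 / ((n : ℝ) + 1) + 1) ^ n ≤ (Real.exp (1 / ((n : ℝ) + 1))) ^ n := by
          gcongr; exact Real.add_one_le_exp _
      _ = Real.exp (n * (1 / ((n : ℝ) + 1))) := (Real.exp_nat_mul _ _).symm
      _ ≤ Real.exp 1 := by
          refine Real.exp_le_exp.2 ?_
          rw [mul_one_div, div_le_one (by positivity)]; linarith
      _ ≤ 3 := by linarith [Real.exp_one_lt_d9]
  have hfac : (0 : ℝ) < n.factorial := by positivity
  rw [norm_mul, norm_inv, Complex.norm_natCast]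
  calc _ ≤ (n.factorial : ℝ)⁻¹ * (n.factorial * (A * ((n : ℝ) + 2) ^ N) / r ^ n) := by gcongr
    _ = A * ((n : ℝ) + 2) ^ N * (r ^ n)⁻¹ := by field_simp
    _ ≤ A * (2 * ((n : ℝ) + 1)) ^ N * 3 := by
        gcongr; linarith
    _ = _ := by rw [mul_pow]; ring

/-- A holomorphic function of polynomial growth has a boundary value in the sense of
distributions. -/
theorem exists_hasBoundaryValue_of_growth {Φ : ℂ → ℂ} (hΦ : DifferentiableOn ℂ Φ disk) {N : ℕ}
    {A : ℝ} (hA : ∀ z ∈ disk, ‖Φ z‖ * (1 - ‖z‖) ^ N ≤ A) :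
    ∃ u : CircleDistribution, HasBoundaryValue Φ u := by
  set a : ℕ → ℂ := fun n => ((n.factorial : ℂ))⁻¹ * iteratedDeriv n Φ 0 with ha
  have hab := norm_taylorCoeff_le hΦ hA
  have hA0 : 0 ≤ A := le_trans (by simp) (hA 0 (by simp [disk]))
  have hser : ∀ z ∈ disk, HasSum (fun n => a n * z ^ n) (Φ z) := by
    intro z hz
    have := Complex.hasSum_taylorSeries_on_ball (c := 0) (r := 1) (f := Φ) (z := z)
      (by simpa [disk] using hΦ) (by simpa [disk] using hz)
    simp only [sub_zero, smul_eq_mul] at this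
    have e : ∀ n : ℕ, (n.factorial : ℂ)⁻¹ * (z ^ n * iteratedDeriv n Φ 0) = a n * z ^ n :=
      fun n => by simp only [ha]; ring
    simpa only [e] using this
  have hsum : ∀ (φ : CircleTest), ∀ r ∈ Ioo (0 : ℝ) 1,
      HasSum (fun n : ℕ => a n * (r : ℂ) ^ n * circleCoeff φ (1 * n))
        (∫ θ in (0 : ℝ)..(2 * Real.pi), Φ (circleMap 0 r θ) * (φ : ℝ → ℂ) θ) := by
    intro φ r hr
    refine hasSum_integral_character_series φ.2.1.continuous ?_ 1 fun θ => ?_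
    · refine (hser r ?_).summable.norm
      rw [mem_disk, Complex.norm_real, Real.norm_of_nonneg hr.1.le]; exact hr.2
    · have e : ∀ n : ℕ, a n * (circleMap 0 r θ) ^ n =
          a n * (r : ℂ) ^ n * Complex.exp ((1 * n : ℤ) * θ * Complex.I) := fun n => by
        rw [circleMap, zero_add, mul_pow, ← Complex.exp_nat_mul]
        push_cast; ring_nf
      simpa only [e] using hser _ (circleMap_mem_disk hr θ)
  set S := ∑' n : ℕ, 1 / ((n : ℝ) + 1) ^ 2 with hS
  have hterm : ∀ (φ : CircleTest) (M : ℝ),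
      (∀ j ≤ N + 2, ∀ θ : ℝ, ‖iteratedDeriv j (φ : ℝ → ℂ) θ‖ ≤ M) →
      ∀ n : ℕ, ‖a n‖ * ‖circleCoeff φ (1 * n)‖ ≤
        3 * 2 ^ N * A * (2 ^ (N + 2) * (2 * Real.pi * M)) * (1 / ((n : ℝ) + 1) ^ 2) := by
    intro φ M hM n
    have h1 := norm_circleCoeff_mul_pow_le_div φ.2.1 φ.2.2 (m := 1 * n) (n := n) (by simp) N hM
    calc _ ≤ 3 * 2 ^ N * A * ((n : ℝ) + 1) ^ N * ‖circleCoeff φ (1 * n)‖ := by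
          gcongr; exact hab n
      _ = 3 * 2 ^ N * A * (‖circleCoeff φ (1 * n)‖ * ((n : ℝ) + 1) ^ N) := by ring
      _ ≤ 3 * 2 ^ N * A * (2 ^ (N + 2) * (2 * Real.pi * M) * (1 / ((n : ℝ) + 1) ^ 2)) := by
          gcongr
      _ = _ := by ring
  have hdom : ∀ (φ : CircleTest), ∀ r ∈ Ioo (0 : ℝ) 1, ∀ n : ℕ,
      ‖a n * (r : ℂ) ^ n * circleCoeff φ (1 * n)‖ ≤ ‖a n‖ * ‖circleCoeff φ (1 * n)‖ := by
    intro φ r hr n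
    rw [norm_mul, norm_mul, norm_pow, Complex.norm_real, Real.norm_of_nonneg hr.1.le]
    gcongr
    exact mul_le_of_le_one_right (norm_nonneg _) (pow_le_one₀ hr.1.le hr.2.le)
  have hIoo : Ioo (0 : ℝ) 1 ∈ 𝓝[<] (1 : ℝ) := Ioo_mem_nhdsLT one_pos
  refine exists_hasBoundaryValue (N + 2) (3 * 2 ^ N * A * (2 ^ (N + 2) * (2 * Real.pi)) * S)
    (fun φ r hr => Continuous.intervalIntegrable ?_ _ _) (fun φ => ?_) (fun φ M hM => ?_)
  · refine Continuous.mul ?_ φ.2.1.continuous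
    exact hΦ.continuousOn.comp_continuous (continuous_circleMap 0 r) (circleMap_mem_disk hr)
  · obtain ⟨M, hM⟩ := CircleTest.exists_bound φ (N + 2)
    refine ⟨∑' n : ℕ, a n * circleCoeff φ (1 * n), ?_⟩
    have hsm : Summable fun n : ℕ => ‖a n‖ * ‖circleCoeff φ (1 * n)‖ :=
      Summable.of_nonneg_of_le (fun _ => by positivity) (hterm φ M hM)
        (summable_one_div_add_one_sq.mul_left _)
    -- The majorant `|a_n|` times the Fourier coefficient does not depend on `r`, so the limit may
    -- be taken termwise.
    have := tendsto_tsum_of_dominated_convergence (𝓕 := 𝓝[<] (1 : ℝ))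
      (f := fun (r : ℝ) (n : ℕ) => a n * (r : ℂ) ^ n * circleCoeff φ (1 * n))
      (g := fun n : ℕ => a n * circleCoeff φ (1 * n)) hsm (fun n => ?_) ?_
    · refine this.congr' ?_
      filter_upwards [hIoo] with r hr
      exact (hsum φ r hr).tsum_eq
    · have hc : Continuous fun r : ℝ => a n * (r : ℂ) ^ n * circleCoeff φ (1 * n) := by fun_prop
      have := (hc.tendsto 1).mono_left (nhdsWithin_le_nhds (s := Iio (1 : ℝ)))
      simpa using this
    · filter_upwards [hIoo] with r hr n using hdom φ r hr n
  · filter_upwards [hIoo] with r hr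
    rw [← (hsum φ r hr).tsum_eq]
    have := tsum_of_norm_bounded (summable_one_div_add_one_sq.hasSum.mul_left _)
      fun n => (hdom φ r hr n).trans (hterm φ M hM n)
    refine this.trans (le_of_eq ?_)
    rw [hS]; ring

/-! ### Boundary values of the modified operator -/

theorem integrable_modified_kernel {f : ℂ → ℂ} (hf : IntegrableOn f disk) {r : ℝ}
    (hr : r ∈ Ioo (0 : ℝ) 1)
    (h : ∫⁻ θ in Ioc 0 (2 * Real.pi), potential f (circleMap 0 r θ) < ⊤) :
    Integrable (fun p : ℝ × ℂ => modifiedIntegrand f (circleMap 0 r p.1) p.2)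
      ((volume.restrict (Ioc 0 (2 * Real.pi))).prod (volume.restrict disk)) := by
  have hm : AEStronglyMeasurable
      (fun p : ℝ × ℂ => modifiedIntegrand f (circleMap 0 r p.1) p.2)
      ((volume.restrict (Ioc 0 (2 * Real.pi))).prod (volume.restrict disk)) := by
    have hc : Continuous fun p : ℝ × ℂ => circleMap 0 r p.1 :=
      (continuous_circleMap 0 r).comp continuous_fst
    have h1 : Continuous fun p : ℝ × ℂ => p.2 - circleMap 0 r p.1 := continuous_snd.sub hc
    have h2 : Continuous fun p : ℝ × ℂ => 1 - conj p.2 * circleMap 0 r p.1 := by fun_prop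
    have h3 : AEStronglyMeasurable (fun ζ => conj (f ζ)) (volume.restrict disk) :=
      Complex.continuous_conj.comp_aestronglyMeasurable hf.1
    have h4 : AEStronglyMeasurable (fun p : ℝ × ℂ => f p.2 * (p.2 - circleMap 0 r p.1)⁻¹)
        ((volume.restrict (Ioc 0 (2 * Real.pi))).prod (volume.restrict disk)) :=
      hf.1.comp_snd.mul h1.measurable.inv.aestronglyMeasurable
    have h5 : AEStronglyMeasurable (fun p : ℝ × ℂ => circleMap 0 r p.1 * conj (f p.2) *
        (1 - conj p.2 * circleMap 0 r p.1)⁻¹)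
        ((volume.restrict (Ioc 0 (2 * Real.pi))).prod (volume.restrict disk)) :=
      (hc.aestronglyMeasurable.mul h3.comp_snd).mul h2.measurable.inv.aestronglyMeasurable
    exact h4.add h5
  refine ⟨hm, ?_⟩
  rw [hasFiniteIntegral_iff_enorm, lintegral_prod _ hm.enorm]
  have hle : ∀ θ : ℝ, ∫⁻ ζ in disk, ‖modifiedIntegrand f (circleMap 0 r θ) ζ‖ₑ ≤
      2 * potential f (circleMap 0 r θ) := fun θ =>
    lintegral_modifiedIntegrand_le f (circleMap_mem_disk hr θ)
  calc ∫⁻ θ in Ioc 0 (2 * Real.pi), ∫⁻ ζ in disk, ‖modifiedIntegrand f (circleMap 0 r θ) ζ‖ₑ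
      ≤ ∫⁻ θ in Ioc 0 (2 * Real.pi), 2 * potential f (circleMap 0 r θ) := lintegral_mono hle
    _ = 2 * ∫⁻ θ in Ioc 0 (2 * Real.pi), potential f (circleMap 0 r θ) :=
        lintegral_const_mul' _ _ ENNReal.ofNat_ne_top
    _ < ⊤ := ENNReal.mul_lt_top ENNReal.ofNat_lt_top h

theorem intervalIntegrable_modifiedT_circle {f : ℂ → ℂ} (hf : IntegrableOn f disk) {r : ℝ}
    (hr : r ∈ Ioo (0 : ℝ) 1)
    (h : ∫⁻ θ in Ioc 0 (2 * Real.pi), potential f (circleMap 0 r θ) < ⊤) :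
    IntervalIntegrable (fun θ => modifiedT f (circleMap 0 r θ)) volume 0 (2 * Real.pi) := by
  rw [intervalIntegrable_iff_integrableOn_Ioc_of_le Real.two_pi_pos.le]
  exact (integrable_modified_kernel hf hr h).integral_prod_left.const_mul _

/-- The product of a test function and a character. -/
noncomputable def mulCharacter (φ : CircleTest) (n : ℤ) : CircleTest :=
  ⟨fun θ => Complex.exp (n * θ * Complex.I) * (φ : ℝ → ℂ) θ, by
    refine ⟨ContDiff.mul ?_ φ.2.1, fun θ => ?_⟩
    · exact ((contDiff_const.mul Complex.ofRealCLM.contDiff).mul contDiff_const).cexp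
    · simp only
      rw [φ.2.2 θ]
      congr 1
      refine Complex.exp_eq_exp_iff_exists_int.2 ⟨n, ?_⟩
      push_cast; ring⟩

theorem circleMap_zero_eq (r θ : ℝ) :
    circleMap 0 r θ = r * Complex.exp ((1 : ℤ) * θ * Complex.I) := by
  simp [circleMap]

/-- Expand the kernel in powers of `ζ/z` or `z/ζ` according to the side of the circle on which `ζ`
lies; both series are bounded uniformly up to the circle. For `|ζ| < r`, factoring out `z = r
e^{iθ}` leaves `e^{-iθ}`, which is absorbed into the test function. The restriction `r ≥ 1/2` keeps
the prefactor at most 2. -/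
theorem exists_norm_integral_sub_inv_le (φ : CircleTest) :
    ∃ B : ℝ, ∀ r ∈ Ico (1 / 2 : ℝ) 1, ∀ ζ : ℂ, ‖ζ‖ ≠ r →
      ‖∫ θ in (0 : ℝ)..(2 * Real.pi), (ζ - circleMap 0 r θ)⁻¹ * (φ : ℝ → ℂ) θ‖ ≤ B := by
  set S1 := ∑' n : ℕ, ‖circleCoeff φ (1 * n)‖
  set S2 := ∑' n : ℕ, ‖circleCoeff (mulCharacter φ (-1)) (-1 * n)‖
  have hS1 : 0 ≤ S1 := tsum_nonneg fun _ => norm_nonneg _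
  have hS2 : 0 ≤ S2 := tsum_nonneg fun _ => norm_nonneg _
  refine ⟨2 * S1 + 2 * S2, fun r hr ζ hζ => ?_⟩
  have hr0 : 0 < r := by linarith [hr.1]
  have hrinv : r⁻¹ ≤ 2 := by
    rw [inv_le_comm₀ hr0 two_pos]; linarith [hr.1]
  have hrC : (r : ℂ) ≠ 0 := by exact_mod_cast hr0.ne'
  rcases lt_or_gt_of_ne hζ with hlt | hgt
  · have hx : ‖ζ / r‖ < 1 := by
      rw [norm_div, Complex.norm_real, Real.norm_of_nonneg hr0.le, div_lt_one hr0]; exact hlt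
    have h1 := norm_integral_div_one_sub_le (mulCharacter φ (-1)) (σ := -1) (by simp) hx
    have e : ∀ θ : ℝ, (ζ - circleMap 0 r θ)⁻¹ * (φ : ℝ → ℂ) θ = (-(r : ℂ)⁻¹) *
        ((1 - ζ / r * Complex.exp ((-1 : ℤ) * θ * Complex.I))⁻¹ *
          ((mulCharacter φ (-1) : CircleTest) : ℝ → ℂ) θ) := by
      intro θ
      have h2 : ζ - circleMap 0 r θ = -(r * Complex.exp ((1 : ℤ) * θ * Complex.I)) *
          (1 - ζ / r * Complex.exp ((-1 : ℤ) * θ * Complex.I)) := by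
        rw [circleMap_zero_eq]
        have h3 : Complex.exp ((1 : ℤ) * θ * Complex.I) *
            Complex.exp ((-1 : ℤ) * θ * Complex.I) = 1 := by
          rw [← Complex.exp_add, ← Complex.exp_zero]; congr 1; push_cast; ring
        generalize Complex.exp ((1 : ℤ) * θ * Complex.I) = a at h3 ⊢
        generalize Complex.exp ((-1 : ℤ) * θ * Complex.I) = b at h3 ⊢
        field_simp
        linear_combination (-ζ) * h3
      have h4 : (Complex.exp ((1 : ℤ) * θ * Complex.I))⁻¹ =
          Complex.exp ((-1 : ℤ) * θ * Complex.I) := by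
        rw [← Complex.exp_neg]; congr 1; push_cast; ring
      rw [h2, mul_inv, inv_neg, mul_inv, h4]
      simp only [mulCharacter]
      ring
    simp only [e]
    rw [intervalIntegral.integral_const_mul, norm_mul, norm_neg, norm_inv, Complex.norm_real,
      Real.norm_of_nonneg hr0.le]
    calc r⁻¹ * _ ≤ 2 * S2 := by gcongr
      _ ≤ _ := by linarith
  · have hζ0 : ζ ≠ 0 := norm_pos_iff.1 (hr0.trans hgt)
    have hζn : 0 < ‖ζ‖ := norm_pos_iff.2 hζ0
    have hx : ‖(r : ℂ) / ζ‖ < 1 := by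
      rw [norm_div, Complex.norm_real, Real.norm_of_nonneg hr0.le, div_lt_one hζn]; exact hgt
    have h1 := norm_integral_div_one_sub_le φ (σ := 1) (by simp) hx
    have e : ∀ θ : ℝ, (ζ - circleMap 0 r θ)⁻¹ * (φ : ℝ → ℂ) θ = ζ⁻¹ *
        ((1 - r / ζ * Complex.exp ((1 : ℤ) * θ * Complex.I))⁻¹ * (φ : ℝ → ℂ) θ) := by
      intro θ
      have h2 : ζ - circleMap 0 r θ = ζ *
          (1 - r / ζ * Complex.exp ((1 : ℤ) * θ * Complex.I)) := by
        rw [circleMap_zero_eq]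
        field_simp
      rw [h2, mul_inv, mul_assoc]
    simp only [e]
    rw [intervalIntegral.integral_const_mul, norm_mul, norm_inv]
    have h3 : ‖ζ‖⁻¹ ≤ 2 := le_trans (by gcongr) hrinv
    calc ‖ζ‖⁻¹ * _ ≤ 2 * S1 := by gcongr
      _ ≤ _ := by linarith

theorem exists_norm_integral_reflected_le (φ : CircleTest) :
    ∃ B : ℝ, ∀ r ∈ Ioo (0 : ℝ) 1, ∀ ζ ∈ disk,
      ‖∫ θ in (0 : ℝ)..(2 * Real.pi),
        circleMap 0 r θ * (1 - conj ζ * circleMap 0 r θ)⁻¹ * (φ : ℝ → ℂ) θ‖ ≤ B := by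
  refine ⟨∑' n : ℕ, ‖circleCoeff (mulCharacter φ 1) (1 * n)‖, fun r hr ζ hζ => ?_⟩
  have hx : ‖conj ζ * r‖ < 1 := by
    rw [norm_mul, RCLike.norm_conj, Complex.norm_real, Real.norm_of_nonneg hr.1.le]
    nlinarith [mem_disk.1 hζ, hr.1, hr.2, norm_nonneg ζ]
  have h1 := norm_integral_div_one_sub_le (mulCharacter φ 1) (σ := 1) (by simp) hx
  have e : ∀ θ : ℝ, circleMap 0 r θ * (1 - conj ζ * circleMap 0 r θ)⁻¹ * (φ : ℝ → ℂ) θ = r *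
      ((1 - conj ζ * r * Complex.exp ((1 : ℤ) * θ * Complex.I))⁻¹ *
        ((mulCharacter φ 1 : CircleTest) : ℝ → ℂ) θ) := by
    intro θ
    rw [circleMap_zero_eq]
    simp only [mulCharacter]
    ring
  simp only [e]
  rw [intervalIntegral.integral_const_mul, norm_mul, Complex.norm_real,
    Real.norm_of_nonneg hr.1.le]
  exact (mul_le_of_le_one_left (norm_nonneg _) hr.2.le).trans h1

theorem sub_circleMap_ne_zero {ζ : ℂ} {r : ℝ} (hr : ‖ζ‖ < r) (θ : ℝ) :
    ζ - circleMap 0 r θ ≠ 0 := by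
  intro h
  rw [sub_eq_zero.1 h, norm_circleMap_zero] at hr
  exact absurd ((le_abs_self r).trans_lt hr) (lt_irrefl _)

theorem one_sub_conj_mul_circleMap_ne_zero {ζ : ℂ} (hζ : ζ ∈ disk) {r : ℝ}
    (hr : r ∈ Icc (0 : ℝ) 1) (θ : ℝ) : 1 - conj ζ * circleMap 0 r θ ≠ 0 := by
  intro h
  have h1 := congrArg norm (sub_eq_zero.1 h)
  rw [norm_one, norm_mul, RCLike.norm_conj, norm_circleMap_zero, abs_of_nonneg hr.1] at h1
  nlinarith [mem_disk.1 hζ, hr.1, hr.2, norm_nonneg ζ]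

/-- For fixed `ζ` in `D` the circles with `r > ρ > |ζ|` stay away from the singularity, and the
reflected pole lies outside the closed disk, so the integrand is continuous up to `r = 1`. -/
theorem tendsto_integral_modifiedIntegrand (f : ℂ → ℂ) (φ : CircleTest) {ζ : ℂ} (hζ : ζ ∈ disk) :
    Tendsto (fun r : ℝ => ∫ θ in (0 : ℝ)..(2 * Real.pi),
      modifiedIntegrand f (circleMap 0 r θ) ζ * (φ : ℝ → ℂ) θ) (𝓝[<] 1)
      (𝓝 (∫ θ in (0 : ℝ)..(2 * Real.pi),
        modifiedIntegrand f (circleMap 0 1 θ) ζ * (φ : ℝ → ℂ) θ)) := by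
  have hζ1 := mem_disk.1 hζ
  have hζ0 := norm_nonneg ζ
  set ρ := (1 + ‖ζ‖) / 2 with hρ
  have hρ1 : ρ < 1 := by linarith
  have hρ0 : 0 < ρ := by linarith
  have hcm : Continuous fun p : ℝ × ℝ => circleMap 0 p.1 p.2 := by
    unfold circleMap; fun_prop
  have hK : ContinuousOn (fun p : ℝ × ℝ =>
      modifiedIntegrand f (circleMap 0 p.1 p.2) ζ * (φ : ℝ → ℂ) p.2) (Icc ρ 1 ×ˢ univ) := by
    unfold modifiedIntegrand
    refine ContinuousOn.mul (ContinuousOn.add ?_ ?_)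
      (φ.2.1.continuous.comp continuous_snd).continuousOn
    · refine continuousOn_const.div (continuous_const.sub hcm).continuousOn fun p hp => ?_
      exact sub_circleMap_ne_zero (by linarith [hp.1.1]) _
    · refine (hcm.mul continuous_const).continuousOn.div
        (continuous_const.sub (continuous_const.mul hcm)).continuousOn fun p hp => ?_
      exact one_sub_conj_mul_circleMap_ne_zero hζ ⟨hρ0.le.trans hp.1.1, hp.1.2⟩ _
  obtain ⟨B, hB⟩ := ((isCompact_Icc (a := ρ) (b := 1)).prod
    (isCompact_Icc (a := (0 : ℝ)) (b := 2 * Real.pi))).exists_bound_of_continuousOn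
      (hK.mono (prod_mono le_rfl (subset_univ _)))
  have hev : ∀ᶠ r in 𝓝[<] (1 : ℝ), r ∈ Ioo ρ 1 := Ioo_mem_nhdsLT hρ1
  refine intervalIntegral.tendsto_integral_filter_of_dominated_convergence (fun _ => B) ?_ ?_
    intervalIntegrable_const (Eventually.of_forall fun θ _ => ?_)
  · filter_upwards [hev] with r hr
    have : Continuous fun θ : ℝ => modifiedIntegrand f (circleMap 0 r θ) ζ * (φ : ℝ → ℂ) θ :=
      hK.comp_continuous (f := fun θ : ℝ => (r, θ)) (by fun_prop)
        fun θ => mk_mem_prod ⟨hr.1.le, hr.2.le⟩ (mem_univ θ)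
    exact this.aestronglyMeasurable
  · filter_upwards [hev] with r hr
    refine Eventually.of_forall fun θ hθ => ?_
    rw [uIoc_of_le Real.two_pi_pos.le] at hθ
    exact hB (r, θ) ⟨⟨hr.1.le, hr.2.le⟩, ⟨hθ.1.le, hθ.2⟩⟩
  · have h1 := hK (1, θ) (mk_mem_prod ⟨hρ1.le, le_rfl⟩ (mem_univ θ))
    have h2 : Tendsto (fun r : ℝ => (r, θ)) (𝓝[<] 1) (𝓝[Icc ρ 1 ×ˢ univ] (1, θ)) := by
      refine tendsto_nhdsWithin_iff.2 ⟨?_, ?_⟩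
      · have : Continuous fun r : ℝ => (r, θ) := continuous_id.prodMk continuous_const
        exact tendsto_nhdsWithin_of_tendsto_nhds (this.tendsto 1)
      · exact hev.mono fun r hr => mk_mem_prod ⟨hr.1.le, hr.2.le⟩ (mem_univ θ)
    have h3 := Tendsto.comp h1.tendsto h2
    simp only [Function.comp_def] at h3
    exact h3

theorem integral_modifiedT_circle_eq {f : ℂ → ℂ} (hf : IntegrableOn f disk) {r : ℝ}
    (hr : r ∈ Ioo (0 : ℝ) 1)
    (h : ∫⁻ θ in Ioc 0 (2 * Real.pi), potential f (circleMap 0 r θ) < ⊤) (φ : CircleTest) :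
    Integrable (fun ζ => ∫ θ in (0 : ℝ)..(2 * Real.pi),
      modifiedIntegrand f (circleMap 0 r θ) ζ * (φ : ℝ → ℂ) θ) (volume.restrict disk) ∧
    ∫ θ in (0 : ℝ)..(2 * Real.pi), modifiedT f (circleMap 0 r θ) * (φ : ℝ → ℂ) θ =
      -(1 / (Real.pi : ℂ)) * ∫ ζ in disk, ∫ θ in (0 : ℝ)..(2 * Real.pi),
        modifiedIntegrand f (circleMap 0 r θ) ζ * (φ : ℝ → ℂ) θ := by
  obtain ⟨M, hM⟩ := CircleTest.exists_bound φ 0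
  have hM' : ∀ θ, ‖(φ : ℝ → ℂ) θ‖ ≤ M := by simpa using hM
  have hi : Integrable (fun p : ℝ × ℂ =>
      modifiedIntegrand f (circleMap 0 r p.1) p.2 * (φ : ℝ → ℂ) p.1)
      ((volume.restrict (Ioc 0 (2 * Real.pi))).prod (volume.restrict disk)) :=
    (integrable_modified_kernel hf hr h).mul_bdd (c := M)
      (φ.2.1.continuous.comp continuous_fst).aestronglyMeasurable
      (Eventually.of_forall fun p => hM' p.1)
  simp only [intervalIntegral.integral_of_le Real.two_pi_pos.le]
  refine ⟨hi.integral_prod_right, ?_⟩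
  simp only [modifiedT, mul_assoc]
  rw [integral_const_mul]
  congr 1
  simp only [← integral_mul_const]
  exact integral_integral_swap hi

theorem exists_norm_integral_modifiedIntegrand_le (f : ℂ → ℂ) (φ : CircleTest) :
    ∃ B : ℝ, ∀ r ∈ Ico (1 / 2 : ℝ) 1, ∀ ζ ∈ disk, ‖ζ‖ ≠ r →
      ‖∫ θ in (0 : ℝ)..(2 * Real.pi),
        modifiedIntegrand f (circleMap 0 r θ) ζ * (φ : ℝ → ℂ) θ‖ ≤ ‖f ζ‖ * B := by
  obtain ⟨B1, hB1⟩ := exists_norm_integral_sub_inv_le φ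
  obtain ⟨B2, hB2⟩ := exists_norm_integral_reflected_le φ
  refine ⟨B1 + B2, fun r hr ζ hζ hne => ?_⟩
  have hr0 : 0 < r := by linarith [hr.1]
  have hφ := φ.2.1.continuous
  have hc := continuous_circleMap 0 r
  have hne' : ∀ θ, ζ - circleMap 0 r θ ≠ 0 := fun θ h0 => hne <| by
    rw [sub_eq_zero.1 h0, norm_circleMap_zero, abs_of_pos hr0]
  have hi1 : Continuous fun θ : ℝ => (ζ - circleMap 0 r θ)⁻¹ * (φ : ℝ → ℂ) θ :=
    ((continuous_const.sub hc).inv₀ hne').mul hφ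
  have hi2 : Continuous fun θ : ℝ =>
      circleMap 0 r θ * (1 - conj ζ * circleMap 0 r θ)⁻¹ * (φ : ℝ → ℂ) θ :=
    (hc.mul ((continuous_const.sub (continuous_const.mul hc)).inv₀
      (one_sub_conj_mul_circleMap_ne_zero hζ ⟨hr0.le, hr.2.le⟩))).mul hφ
  have e : ∀ θ : ℝ, modifiedIntegrand f (circleMap 0 r θ) ζ * (φ : ℝ → ℂ) θ =
      f ζ * ((ζ - circleMap 0 r θ)⁻¹ * (φ : ℝ → ℂ) θ) + conj (f ζ) *
        (circleMap 0 r θ * (1 - conj ζ * circleMap 0 r θ)⁻¹ * (φ : ℝ → ℂ) θ) := fun θ => by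
    rw [modifiedIntegrand]; ring
  simp only [e]
  rw [intervalIntegral.integral_add ((hi1.intervalIntegrable _ _).const_mul _)
    ((hi2.intervalIntegrable _ _).const_mul _), intervalIntegral.integral_const_mul,
    intervalIntegral.integral_const_mul]
  refine (norm_add_le _ _).trans ?_
  rw [norm_mul, norm_mul, RCLike.norm_conj, mul_add]
  gcongr
  · exact hB1 r hr ζ hne
  · exact hB2 r ⟨hr0, hr.2⟩ ζ hζ

theorem ae_norm_ne (r : ℝ) (hr : r ≠ 0) : ∀ᵐ ζ : ℂ, ‖ζ‖ ≠ r := by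
  have : {ζ : ℂ | ¬ ‖ζ‖ ≠ r} = Metric.sphere 0 r := by ext ζ; simp
  rw [ae_iff, this]
  exact Measure.addHaar_sphere_of_ne_zero _ _ hr

/-- The modified operator has boundary values in the sense of distributions. -/
theorem exists_hasBoundaryValue_modifiedT {f : ℂ → ℂ} (hf : IntegrableOn f disk) {C : ℝ≥0∞}
    (hC : C ≠ ⊤) (h : ∀ r ∈ Ioo (0 : ℝ) 1,
      ∫⁻ θ in Ioc 0 (2 * Real.pi), potential f (circleMap 0 r θ) ≤ (ENNReal.ofReal r)⁻¹ * C) :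
    ∃ u : CircleDistribution, HasBoundaryValue (modifiedT f) u := by
  have hfin : ∀ r ∈ Ioo (0 : ℝ) 1,
      ∫⁻ θ in Ioc 0 (2 * Real.pi), potential f (circleMap 0 r θ) < ⊤ := fun r hr =>
    (h r hr).trans_lt (ENNReal.mul_lt_top (by simpa using hr.1) hC.lt_top)
  have hev : ∀ᶠ r in 𝓝[<] (1 : ℝ), r ∈ Ioo (1 / 2 : ℝ) 1 := Ioo_mem_nhdsLT (by norm_num)
  have hmem : ∀ r ∈ Ioo (1 / 2 : ℝ) 1, r ∈ Ioo (0 : ℝ) 1 := fun r hr =>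
    ⟨by linarith [hr.1], hr.2⟩
  refine exists_hasBoundaryValue 0 (2 * C).toReal (fun φ r hr => ?_) (fun φ => ?_)
    fun φ M hM => ?_
  · exact (intervalIntegrable_modifiedT_circle hf hr (hfin r hr)).mul_continuousOn
      φ.2.1.continuous.continuousOn
  -- The limit is the pairing of the kernel on the unit circle, integrated against `ζ`. Dominated
  -- convergence applies with majorant `B|f|`, since for each `r` the excluded circle `|ζ| = r` is
  -- null.
  · refine ⟨-(1 / (Real.pi : ℂ)) * ∫ ζ in disk, ∫ θ in (0 : ℝ)..(2 * Real.pi),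
        modifiedIntegrand f (circleMap 0 1 θ) ζ * (φ : ℝ → ℂ) θ, ?_⟩
    obtain ⟨B, hB⟩ := exists_norm_integral_modifiedIntegrand_le f φ
    have hlim := tendsto_integral_filter_of_dominated_convergence (μ := volume.restrict disk)
      (l := 𝓝[<] (1 : ℝ)) (F := fun (r : ℝ) ζ => ∫ θ in (0 : ℝ)..(2 * Real.pi),
        modifiedIntegrand f (circleMap 0 r θ) ζ * (φ : ℝ → ℂ) θ)
      (fun ζ => ‖f ζ‖ * B) ?_ ?_ (hf.norm.mul_const B)
      ((ae_restrict_mem measurableSet_ball).mono fun ζ hζ =>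
        tendsto_integral_modifiedIntegrand f φ hζ)
    · refine (hlim.const_mul _).congr' ?_
      filter_upwards [hev] with r hr
      exact (integral_modifiedT_circle_eq hf (hmem r hr) (hfin r (hmem r hr)) φ).2.symm
    · filter_upwards [hev] with r hr
      exact (integral_modifiedT_circle_eq hf (hmem r hr) (hfin r (hmem r hr)) φ).1.1
    · filter_upwards [hev] with r hr
      filter_upwards [ae_restrict_mem measurableSet_ball,
        ae_restrict_of_ae (ae_norm_ne r (hmem r hr).1.ne')] with ζ hζ hne
      exact hB r ⟨hr.1.le, hr.2⟩ ζ hζ hne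
  · filter_upwards [hev] with r hr
    have hr' := hmem r hr
    have hM' : ∀ θ, ‖(φ : ℝ → ℂ) θ‖ ≤ M := by simpa using hM
    have hM0 : 0 ≤ M := (norm_nonneg _).trans (hM' 0)
    have hi := intervalIntegrable_modifiedT_circle hf hr' (hfin r hr')
    -- The circle means of `T̃f` are bounded in `L¹`, so its boundary distribution has order 0. The
    -- factor 2 is the bound for `1/r` when `r > 1/2`.
    have h1 : ∫ θ in (0 : ℝ)..(2 * Real.pi), ‖modifiedT f (circleMap 0 r θ)‖ ≤
        (2 * C).toReal := by
      rw [intervalIntegral.integral_of_le Real.two_pi_pos.le, integral_norm_eq_lintegral_enorm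
        ((intervalIntegrable_iff_integrableOn_Ioc_of_le Real.two_pi_pos.le).1 hi).1]
      refine ENNReal.toReal_mono (ENNReal.mul_ne_top (by simp) hC) ?_
      refine (lintegral_mono fun θ => enorm_modifiedT_le f (circleMap_mem_disk hr' θ)).trans
        ((h r hr').trans ?_)
      gcongr
      rw [ENNReal.inv_le_iff_inv_le, ← ENNReal.ofReal_ofNat,
        ← ENNReal.ofReal_inv_of_pos two_pos]
      exact ENNReal.ofReal_le_ofReal (by linarith [hr.1])
    calc _ ≤ ∫ θ in (0 : ℝ)..(2 * Real.pi), ‖modifiedT f (circleMap 0 r θ)‖ * M := by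
          refine intervalIntegral.norm_integral_le_of_norm_le Real.two_pi_pos.le
            (Eventually.of_forall fun θ _ => ?_) (hi.norm.mul_const _)
          rw [norm_mul]
          gcongr
          exact hM' θ
      _ ≤ _ := by
          rw [intervalIntegral.integral_mul_const]
          gcongr

/-! ### Exceptional sets, membership in the Hardy space and sums of boundary values -/

theorem ae_of_ae_restrict_Ioc_of_periodic {P : ℝ → Prop} {T : ℝ} (hT : 0 < T)
    (hP : Function.Periodic P T) (h : ∀ᵐ θ ∂(volume.restrict (Ioc 0 T)), P θ) :
    ∀ᵐ θ : ℝ, P θ := by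
  rw [ae_restrict_iff' measurableSet_Ioc] at h
  have h1 : ∀ n : ℤ, ∀ᵐ θ : ℝ, θ - n • T ∈ Ioc 0 T → P (θ - n • T) := fun n =>
    (measurePreserving_sub_right volume (n • T)).quasiMeasurePreserving.ae h
  filter_upwards [ae_all_iff.2 h1] with θ hθ
  obtain ⟨n, hn, -⟩ := existsUnique_sub_zsmul_mem_Ioc hT θ 0
  rw [zero_add] at hn
  have := hθ n hn
  rwa [hP.sub_zsmul_eq n] at this

theorem ae_potential_circle_lt_top {f : ℂ → ℂ} (hf : IntegrableOn f disk) {r : ℝ}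
    (h : ∫⁻ θ in Ioc 0 (2 * Real.pi), potential f (circleMap 0 r θ) < ⊤) :
    ∀ᵐ θ : ℝ, potential f (circleMap 0 r θ) < ⊤ := by
  refine ae_of_ae_restrict_Ioc_of_periodic Real.two_pi_pos
    (fun θ => by rw [periodic_circleMap 0 r θ]) ?_
  refine ae_lt_top' ?_ h.ne
  have hm : AEMeasurable (fun p : ℝ × ℂ => ‖f p.2‖ₑ * ‖circleMap 0 r p.1 - p.2‖ₑ⁻¹)
      ((volume.restrict (Ioc 0 (2 * Real.pi))).prod (volume.restrict disk)) := by
    refine hf.1.comp_snd.enorm.mul (Measurable.aemeasurable ?_)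
    have : Continuous fun p : ℝ × ℂ => circleMap 0 r p.1 - p.2 := by
      unfold circleMap; fun_prop
    exact this.measurable.enorm.inv
  exact hm.lintegral_prod_right'

theorem ae_potential_disk_lt_top {f : ℂ → ℂ} (hf : IntegrableOn f disk) :
    ∀ᵐ z ∂(volume.restrict disk), potential f z < ⊤ :=
  (integrable_cauchy_kernel hf 1).prod_right_ae.mono fun _ hz =>
    potential_lt_top_of_integrableOn hz

/-- For `r > 1/2`, subadditivity of `x ↦ x^p` and `x^p ≤ 1 + x` reduce the claim to the bounds on
`w` and on the potential. The potential bound degenerates like `1/r` at the origin, so for `r ≤ 1/2`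
the continuity of `Φ` on a compact disc is used instead. -/
theorem mem_holHardy_of_eq_add {p : ℝ} (hp0 : 0 < p) (hp1 : p ≤ 1) {f w Φ : ℂ → ℂ}
    (hf : IntegrableOn f disk) (hw : hardyNorm p w < ⊤) (hΦ : DifferentiableOn ℂ Φ disk)
    {C : ℝ≥0∞} (hC : C ≠ ⊤) (hpot : ∀ r ∈ Ioo (0 : ℝ) 1,
      ∫⁻ θ in Ioc 0 (2 * Real.pi), potential f (circleMap 0 r θ) ≤ (ENNReal.ofReal r)⁻¹ * C)
    (he : ∀ r ∈ Ioo (0 : ℝ) 1, ∀ᵐ θ : ℝ,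
      w (circleMap 0 r θ) = Φ (circleMap 0 r θ) + modifiedT f (circleMap 0 r θ)) :
    Φ ∈ HolHardy p := by
  obtain ⟨K, hK, hwK⟩ := (hardyNorm_lt_top_iff hp0 w).1 hw
  obtain ⟨B, hB⟩ := (isCompact_closedBall (0 : ℂ) (1 / 2)).exists_bound_of_continuousOn
    (hΦ.continuousOn.mono (Metric.closedBall_subset_ball (by norm_num)))
  set V : ℝ≥0∞ := volume (Ioc (0 : ℝ) (2 * Real.pi)) with hV
  have hVt : V ≠ ⊤ := measure_Ioc_lt_top.ne
  refine ⟨hΦ, (hardyNorm_lt_top_iff hp0 Φ).2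
    ⟨ENNReal.ofReal B ^ p * V + (K + (V + 2 * C)), ?_, fun r hr => ?_⟩⟩
  · simp [ENNReal.add_eq_top, ENNReal.mul_eq_top, hVt, hK, hC, hp0.le]
  rcases le_or_gt r (1 / 2) with hr2 | hr2
  · refine le_trans ?_ le_self_add
    rw [hV, ← setLIntegral_const]
    refine lintegral_mono fun θ => ?_
    gcongr
    rw [← ofReal_norm]
    refine ENNReal.ofReal_le_ofReal (hB _ ?_)
    rw [mem_closedBall_zero_iff, norm_circleMap_zero, abs_of_pos hr.1]
    exact hr2
  · refine le_trans ?_ le_add_self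
    have hfin := (hpot r hr).trans_lt (ENNReal.mul_lt_top (by simpa using hr.1) hC.lt_top)
    have hTi := (intervalIntegrable_iff_integrableOn_Ioc_of_le Real.two_pi_pos.le).1
      (intervalIntegrable_modifiedT_circle hf hr hfin)
    have hT2 : ∫⁻ θ in Ioc 0 (2 * Real.pi), ‖modifiedT f (circleMap 0 r θ)‖ₑ ≤ 2 * C := by
      refine (lintegral_mono fun θ => enorm_modifiedT_le f (circleMap_mem_disk hr θ)).trans
        ((hpot r hr).trans ?_)
      gcongr
      rw [ENNReal.inv_le_iff_inv_le, ← ENNReal.ofReal_ofNat,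
        ← ENNReal.ofReal_inv_of_pos two_pos]
      exact ENNReal.ofReal_le_ofReal (by linarith)
    have hpow : ∀ x : ℝ≥0∞, x ^ p ≤ 1 + x := fun x => by
      rcases le_total x 1 with h | h
      · exact (ENNReal.rpow_le_one h hp0.le).trans le_self_add
      · calc x ^ p ≤ x ^ (1 : ℝ) := ENNReal.rpow_le_rpow_of_exponent_le h hp1
          _ = x := ENNReal.rpow_one x
          _ ≤ _ := le_add_self
    calc ∫⁻ θ in Ioc 0 (2 * Real.pi), ‖Φ (circleMap 0 r θ)‖ₑ ^ p
        ≤ ∫⁻ θ in Ioc 0 (2 * Real.pi), (‖w (circleMap 0 r θ)‖ₑ ^ p +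
            (1 + ‖modifiedT f (circleMap 0 r θ)‖ₑ)) := by
          refine lintegral_mono_ae (ae_restrict_of_ae ((he r hr).mono fun θ hθ => ?_))
          have e : Φ (circleMap 0 r θ) =
              w (circleMap 0 r θ) - modifiedT f (circleMap 0 r θ) := by rw [hθ]; ring
          calc ‖Φ (circleMap 0 r θ)‖ₑ ^ p ≤
              (‖w (circleMap 0 r θ)‖ₑ + ‖modifiedT f (circleMap 0 r θ)‖ₑ) ^ p := by
                rw [e]; gcongr; exact enorm_sub_le
            _ ≤ ‖w (circleMap 0 r θ)‖ₑ ^ p + ‖modifiedT f (circleMap 0 r θ)‖ₑ ^ p :=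
                ENNReal.rpow_add_le_add_rpow _ _ hp0.le hp1
            _ ≤ _ := add_le_add le_rfl (hpow _)
      _ = (∫⁻ θ in Ioc 0 (2 * Real.pi), ‖w (circleMap 0 r θ)‖ₑ ^ p) +
            (V + ∫⁻ θ in Ioc 0 (2 * Real.pi), ‖modifiedT f (circleMap 0 r θ)‖ₑ) := by
          have hm : AEMeasurable (fun θ => 1 + ‖modifiedT f (circleMap 0 r θ)‖ₑ)
              (volume.restrict (Ioc 0 (2 * Real.pi))) := hTi.1.enorm.const_add 1
          rw [lintegral_add_right' _ hm,
            lintegral_add_left measurable_const, setLIntegral_const, one_mul]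
      _ ≤ _ := add_le_add (hwK r hr) (add_le_add le_rfl hT2)

theorem HasBoundaryValue.add {g h : ℂ → ℂ} {u v : CircleDistribution}
    (hg : HasBoundaryValue g u) (hh : HasBoundaryValue h v) :
    HasBoundaryValue (fun z => g z + h z) (u + v) := by
  intro φ
  have hi := fun r (hr : r ∈ Ioo (0 : ℝ) 1) => ((hg φ).1 r hr).add ((hh φ).1 r hr)
  refine ⟨fun r hr => ?_, ?_⟩
  · simpa only [add_mul] using hi r hr
  · have := (hg φ).2.add (hh φ).2
    refine this.congr' ?_
    filter_upwards [Ioo_mem_nhdsLT (one_pos : (0 : ℝ) < 1)] with r hr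
    simp only [add_mul]
    exact (intervalIntegral.integral_add ((hg φ).1 r hr) ((hh φ).1 r hr)).symm

theorem HasBoundaryValue.congr {g h : ℂ → ℂ} {u : CircleDistribution}
    (hg : HasBoundaryValue g u)
    (he : ∀ r ∈ Ioo (0 : ℝ) 1, ∀ᵐ θ : ℝ, h (circleMap 0 r θ) = g (circleMap 0 r θ)) :
    HasBoundaryValue h u := by
  intro φ
  have hae : ∀ r ∈ Ioo (0 : ℝ) 1, ∀ᵐ θ : ℝ, g (circleMap 0 r θ) * (φ : ℝ → ℂ) θ =
      h (circleMap 0 r θ) * (φ : ℝ → ℂ) θ := fun r hr =>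
    (he r hr).mono fun θ hθ => by rw [hθ]
  refine ⟨fun r hr => ((hg φ).1 r hr).congr_ae (ae_restrict_of_ae (hae r hr)),
    (hg φ).2.congr' ?_⟩
  filter_upwards [Ioo_mem_nhdsLT (one_pos : (0 : ℝ) < 1)] with r hr
  exact intervalIntegral.integral_congr_ae ((hae r hr).mono fun θ hθ _ => hθ)

end VekuaHardy

/-! ### The representation and its boundary values -/

theorem mainTheorem7 (p : ℝ) (hp0 : 0 < p) (hp1 : p ≤ 1) (q : ℝ≥0∞) (hq : 1 < q)
    (f w : ℂ → ℂ) (hw : w ∈ HardyClassLq p f q) :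
    ∃ Φ ∈ HolHardy p,
      -- the representation, at almost every point of the disk and of each circle, and at every
      -- point where the integral converges and `w` takes its Lebesgue value
      (∀ᵐ z ∂(volume.restrict disk), ModifiedDefinedAt f z ∧ w z = Φ z + modifiedT f z) ∧
      (∀ r ∈ Ioo (0 : ℝ) 1, ∀ᵐ θ : ℝ, ModifiedDefinedAt f (circleMap 0 r θ) ∧
        w (circleMap 0 r θ) = Φ (circleMap 0 r θ) + modifiedT f (circleMap 0 r θ)) ∧
      (∀ z ∈ disk, ModifiedDefinedAt f z → IsPreciseAt w z → w z = Φ z + modifiedT f z) ∧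
      -- the boundary values
      ∃ wb Φb Tb : CircleDistribution,
        HasBoundaryValue w wb ∧ HasBoundaryValue Φ Φb ∧ HasBoundaryValue (modifiedT f) Tb ∧
          wb = Φb + Tb := by
  obtain ⟨hfq, hsol, hprec, hnorm⟩ := hw
  have hf : IntegrableOn f disk := memLp_one_iff_integrable.1 (hfq.mono_exponent hq.le)
  obtain ⟨C, hC, hpot⟩ := exists_lintegral_potential_circle_le hq hfq
  obtain ⟨g, hg, he⟩ := exists_eq_add_cauchyTransform hsol hf
  -- Moving the reflected term from `T̃f` into the holomorphic part turns `g + Cf` into `Φ + T̃f`.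
  have hΦd : DifferentiableOn ℂ (fun z => g z - reflectedTransform f z) disk :=
    hg.sub (differentiableOn_reflectedTransform hf)
  have hdisk : ∀ᵐ z ∂(volume.restrict disk), ModifiedDefinedAt f z ∧
      w z = (g z - reflectedTransform f z) + modifiedT f z := by
    filter_upwards [ae_potential_disk_lt_top hf, ae_restrict_mem measurableSet_ball,
      ae_restrict_of_ae he] with z hz hzd hez
    have hdef := modifiedDefinedAt_of_potential_lt_top hf hzd hz
    refine ⟨hdef, ?_⟩
    rw [hez hzd, modifiedT_eq_add hf hzd hdef]
    ring
  have hpt : ∀ z ∈ disk, ModifiedDefinedAt f z → IsPreciseAt w z →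
      w z = (g z - reflectedTransform f z) + modifiedT f z := by
    intro z hz hdef hpz
    -- Preciseness forces `w z` to be the Lebesgue value `g z + Cf(z)`, with no exceptional set.
    rw [hpz _ (hasLebesgueValue_add_cauchyTransform hf hg he hz
      (potential_lt_top_of_modifiedDefinedAt hf hz hdef)), modifiedT_eq_add hf hz hdef]
    ring
  have hcirc : ∀ r ∈ Ioo (0 : ℝ) 1, ∀ᵐ θ : ℝ, ModifiedDefinedAt f (circleMap 0 r θ) ∧
      w (circleMap 0 r θ) = (g (circleMap 0 r θ) - reflectedTransform f (circleMap 0 r θ)) +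
        modifiedT f (circleMap 0 r θ) := by
    intro r hr
    have hfin := (hpot r hr).trans_lt (ENNReal.mul_lt_top (by simpa using hr.1) hC.lt_top)
    filter_upwards [ae_potential_circle_lt_top hf hfin, hprec r hr] with θ hθ hpθ
    have hz := circleMap_mem_disk hr θ
    have hdef := modifiedDefinedAt_of_potential_lt_top hf hz hθ
    exact ⟨hdef, hpt _ hz hdef hpθ⟩
  have hΦ := mem_holHardy_of_eq_add hp0 hp1 hf hnorm hΦd hC hpot
    fun r hr => (hcirc r hr).mono fun θ hθ => hθ.2
  obtain ⟨N, A, hA⟩ := exists_growth_of_hardy hp0 hp1 hΦ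
  obtain ⟨Φb, hΦb⟩ := exists_hasBoundaryValue_of_growth hΦd hA
  obtain ⟨Tb, hTb⟩ := exists_hasBoundaryValue_modifiedT hf hC hpot
  exact ⟨_, hΦ, hdisk, hcirc, hpt, Φb + Tb, Φb, Tb,
    (hΦb.add hTb).congr fun r hr => (hcirc r hr).mono fun θ hθ => hθ.2, hΦb, hTb, rfl⟩
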